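/- **Workload upper bound.** Fix a number $I$ of job types, service rates $\mu_1,\dots,\mu_I>0$ and a constant $\varepsilon_0\in(0,1)$. For each $n$ consider a multiserver-job system with $n$ servers: type $i$ jobs arrive according to a Poisson process of rate $\lambda_i=\lambda_i^{(n)}\ge 0$; each needs $\ell_i=\ell_i^{(n)}\in\{1,2,\dots\}$ servers simultaneously and has an exponential service time of rate $\mu_i$; all arrivals and service times are independent. A (possibly preemptive) Markovian scheduling policy, with countable state space and bounded transition rates, decides which jobs are in service. Let $X_i(t)$ and $Z_i(t)$ be the numbers of type $i$ jobs in the system and in service at time $t$, so that $Z_i(t)\le X_i(t)$ and $\sum_i \ell_i Z_i(t)\le n$, and let $Q_i=X_i-Z_i$; the argument $\infty$ refers to a steady-state (stationary) distribution. Put $$\delta=n-\sum_{i=1}^I\frac{\lambda_i\ell_i}{\mu_i},\qquad \sigma^2=\sum_{i=1}^I\frac{\lambda_i\ell_i^2}{\mu_i^2},$$ and assume $\delta>0$ for all large $n$. For $\delta'\ge 0$, a policy is called $\delta'$-work-conserving if $\sum_i\ell_iZ_i(t)\ge\min\left(\sum_i\ell_iX_i(t),\,n-\delta'\right)$ for all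 $t\ge0$. Consider $n\to\infty$, where $\lambda_i$, $\ell_i$, $\delta'$ and the policy may depend on $n$, while $I$, $\mu_i$ and $\varepsilon_0$ do not. Then, for every $\delta'$-work-conserving policy with $\delta'\le\varepsilon_0\delta$ and each of its stationary distributions: 1. if $\delta=o\left(\frac{\sqrt{\sigma^2}}{\log n}\right)$, then $$\mathbb E\left[\sum_{i=1}^I\frac{\ell_i}{\mu_i}Q_i(\infty)\right]\le\frac{\sigma^2}{\delta-\delta'}\,(1+o(1))=O\left(\frac{\sigma^2}{\delta}\right);$$ 2. if $\delta=\Omega\left(\frac{\sqrt{\sigma^2}}{\log n}\right)$, that is, $\frac{\sqrt{\sigma^2}}{\log n}=O(\delta)$, then $$\mathbb E\left[\sum_{i=1}^I\frac{\ell_i}{\mu_i}Q_i(\infty)\right]=O\left(\sqrt{\sigma^2}\,\log n\right).$$ The $o(1)$ term and the constants in $O(\cdot)$ do not depend on $\delta'$ or on the policy. -/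

import Mathlib

open Filter Asymptotics Topology
open scoped ENNReal NNReal

universe u

noncomputable section

namespace MultiserverJob

/-- Slack capacity `δ = n - ∑ i, λ i * ℓ i / μ i` of the system with `n` servers, arrival rates
`lam`, service rates `mu` and server needs `ell`. -/
def slack {I : ℕ} (n : ℕ) (lam mu : Fin I → ℝ) (ell : Fin I → ℕ) : ℝ :=
  (n : ℝ) - ∑ i, lam i * (ell i : ℝ) / mu i

/-- Work variability `σ² = ∑ i, λ i * (ℓ i)² / (μ i)²`. -/
def workVariability {I : ℕ} (lam mu : Fin I → ℝ) (ell : Fin I → ℕ) : ℝ :=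
  ∑ i, lam i * (ell i : ℝ) ^ 2 / mu i ^ 2

/-- A (possibly preemptive, randomized and history dependent) Markovian scheduling policy for the
multiserver-job system with `n` servers and server needs `ell`, with state space `S`.
A state may record anything the policy uses: for instance the list of the jobs present in order of
arrival with a mark on those in service, together with the memory of the policy. -/
structure Policy {I : ℕ} (n : ℕ) (ell : Fin I → ℕ) (S : Type*) where
  /-- `X s i`: number of type `i` jobs in the system. -/
  X : S → Fin I → ℕ
  /-- `Z s i`: number of type `i` jobs in service. -/
  Z : S → Fin I → ℕ
  /-- The jobs in service are among the jobs in the system. -/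
  Z_le_X : ∀ s i, Z s i ≤ X s i
  /-- There are `n` servers, and a type `i` job in service occupies `ell i` of them. -/
  capacity : ∀ s, ∑ i, ell i * Z s i ≤ n
  /-- Law of the new state, as chosen by the policy, when a type `i` job arrives. -/
  arrival : Fin I → S → PMF S
  arrival_X : ∀ i s, ∀ s' ∈ (arrival i s).support, X s' = X s + Pi.single i 1
  /-- Law of the new state when a type `i` job in service completes and leaves. -/
  departure : Fin I → S → PMF S
  departure_X : ∀ i s, 0 < Z s i → ∀ s' ∈ (departure i s).support, X s' + Pi.single i 1 = X s
  /-- The policy may also revise its schedule between arrivals and departures, at the ticks of a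
  Poisson clock of its own (rate `0` if it never does so). A tick need not change the state, so
  this covers all state-dependent bounded rates of rescheduling. -/
  clockRate : ℝ≥0
  /-- Law of the new state at a tick of this clock. -/
  reschedule : S → PMF S
  reschedule_X : ∀ s, ∀ s' ∈ (reschedule s).support, X s' = X s

namespace Policy

variable {I : ℕ} {n : ℕ} {ell : Fin I → ℕ} {S : Type*}

/-- Transition rates: type `i` jobs arrive at rate `lam i`, and each of the `Z s i` type `i` jobs
in service completes at rate `mu i`. -/
def rate (pol : Policy n ell S) (lam mu : Fin I → ℝ) (s s' : S) : ℝ :=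
  (∑ i, lam i * (pol.arrival i s s').toReal)
    + (∑ i, mu i * (pol.Z s i : ℝ) * (pol.departure i s s').toReal)
    + (pol.clockRate : ℝ) * (pol.reschedule s s').toReal

open Classical in
/-- Generator matrix of the chain: off the diagonal it is the transition rate, and every row
sums to `0`. -/
def generator (pol : Policy n ell S) (lam mu : Fin I → ℝ) (s s' : S) : ℝ :=
  pol.rate lam mu s s' - if s = s' then ∑' u, pol.rate lam mu s u else 0

/-- `δ'`-work-conserving: at all times the number of busy servers is at least the minimum of the
total server need and `n - δ'`. Both sides are functions of the current state. -/
def WorkConserving (pol : Policy n ell S) (δ' : ℝ) : Prop :=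
  ∀ s, min (∑ i, (ell i : ℝ) * (pol.X s i : ℝ)) ((n : ℝ) - δ') ≤
    ∑ i, (ell i : ℝ) * (pol.Z s i : ℝ)

end Policy

open Classical in
/-- `P` is the transition function (`P t s s'` being the probability to be in `s'` at time `u + t`
given the state `s` at time `u`) of a continuous-time Markov chain with generator matrix `G`. -/
structure IsTransitionFunction {S : Type*} (G : S → S → ℝ) (P : ℝ≥0 → S → PMF S) : Prop where
  zero : ∀ s, P 0 s = PMF.pure s
  add : ∀ t u s, P (t + u) s = (P t s).bind (P u)
  deriv_zero : ∀ s s', Tendsto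
    (fun t : ℝ≥0 => ((P t s s').toReal - if s = s' then 1 else 0) / (t : ℝ)) (𝓝[>] 0) (𝓝 (G s s'))

namespace Policy

variable {I : ℕ} {n : ℕ} {ell : Fin I → ℕ} {S : Type*}

/-- `π` is a steady-state (stationary) distribution of the system under the policy. -/
def IsSteadyState (pol : Policy n ell S) (lam mu : Fin I → ℝ) (π : PMF S) : Prop :=
  ∃ P : ℝ≥0 → S → PMF S,
    IsTransitionFunction (pol.generator lam mu) P ∧ ∀ t, π.bind (P t) = π

/-- Workload `∑ i, (ℓ i / μ i) * Q i` of a state, with `Q = X - Z` the numbers of jobs waiting. -/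
def workload (pol : Policy n ell S) (mu : Fin I → ℝ) (s : S) : ℝ :=
  ∑ i, (ell i : ℝ) / mu i * ((pol.X s i : ℝ) - (pol.Z s i : ℝ))

/-- Expected workload under the distribution `π` of the state, with values in `[0, ∞]`. -/
def expectedWorkload (pol : Policy n ell S) (mu : Fin I → ℝ) (π : PMF S) : ℝ≥0∞ :=
  ∑' s, π s * ENNReal.ofReal (pol.workload mu s)

end Policy

end MultiserverJob

end

/-! ### Global balance for a stationary law of a continuous-time chain -/

section TransitionFunction

/-! The proof is the drift method (generator applied to test functions, mean zero in steady state)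
applied to the total work `W = ∑ (ℓ i / μ i) X i`. Let `D` be the number of busy servers minus its
mean and `γ = δ - δ'`. Then `D ≤ δ` and `D` has mean `0`, and the quadratic test function `W ^ 2`,
suitably truncated, gives `E[W D] ≤ σ²`. Since `D` has mean `0`, any constant may be subtracted from
`W` here; the right one is the mean `c` of the work in service.

Work conservation enters through a dichotomy: where `D < γ` there is no queue, so `X = Z`, and `W -
c` is comparable to `D` up to a multiple of the shortfall `V` of the `X i` below `λ i / μ i`. Hence
the event `D < 0` contributes little, and `γ E[(W - c) 1{D ≥ γ}]` is at most `σ²` plus errors. The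
workload vanishes off `{D ≥ γ}` and equals `W` minus the work in service on it.

The errors are governed by `V`. Departures are never faster than with infinitely many servers, which
yields a fourth moment bound `E[V ^ 4] = O(σ⁴)`. Cutting `V` at `T = σ Λ`, the excess costs only
`O(σ² / Λ²)`, while the part below `T` costs a multiple of `T E[D⁺]` and of `γ T`. Using `E[D⁺] ≤ δ`
gives the sharp bound of the first case. For large `δ` the same inequality, read as a quadratic
inequality for `E[D⁺]`, shows `E[D⁺] = O(σ Λ)` independently of `δ`, which gives the second case.
Finally `Λ = log n`.

The main steps are `integral_drift_eq_zero`, `integral_min_work_mul_busyDev_le`,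
`integral_posPart_pow_four_le`, `sq_integral_posPart_le`, `mul_integral_le_of_drift` and
`exists_const_expectedWorkload_le`. -/

theorem PMF.hasSum_toReal {S : Type*} (p : PMF S) : HasSum (fun s => (p s).toReal) 1 := by
  have h := ENNReal.hasSum_toReal (f := fun s => p s) (by rw [p.tsum_coe]; exact ENNReal.one_ne_top)
  have h2 := ENNReal.tsum_toReal_eq (f := fun s => p s) (fun s => p.apply_ne_top s)
  rw [p.tsum_coe, ENNReal.toReal_one] at h2
  rwa [← h2] at h

theorem PMF.toReal_le_one {S : Type*} (p : PMF S) (s : S) : (p s).toReal ≤ 1 :=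
  ENNReal.toReal_le_of_le_ofReal zero_le_one (by simpa using p.coe_le_one s)

theorem PMF.hasSum_toReal_mul {S : Type*} (p : PMF S) (f : S → ℝ) (c : ℝ)
    (hf : ∀ s ∈ p.support, f s = c) : HasSum (fun s => (p s).toReal * f s) c := by
  have h := p.hasSum_toReal.mul_right c
  rw [one_mul] at h
  refine (congrArg (fun g => HasSum g c) (funext fun s => ?_)).mpr h
  by_cases hs : s ∈ p.support
  · rw [hf s hs]
  · rw [PMF.mem_support_iff, not_not] at hs
    simp [hs]

namespace MultiserverJob

namespace IsTransitionFunction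

variable {S : Type*} {G : S → S → ℝ} {P : ℝ≥0 → S → PMF S}

theorem diag_mul_le (h : IsTransitionFunction G P) (t u : ℝ≥0) (s : S) :
    (P t s s).toReal * (P u s s).toReal ≤ (P (t + u) s s).toReal := by
  rw [h.add, PMF.bind_apply, ← ENNReal.toReal_mul]
  apply ENNReal.toReal_mono
  · have := ((P t s).bind (P u)).apply_ne_top s
    rwa [PMF.bind_apply] at this
  · exact ENNReal.le_tsum s

theorem one_sub_diag_add_le (h : IsTransitionFunction G P) (t u : ℝ≥0) (s : S) :
    1 - (P (t + u) s s).toReal ≤ (1 - (P t s s).toReal) + (1 - (P u s s).toReal) := by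
  have h1 := h.diag_mul_le t u s
  have h2 := (P t s).toReal_le_one s
  have h3 := (P u s).toReal_le_one s
  nlinarith

theorem one_sub_diag_nsmul_le (h : IsTransitionFunction G P) (t : ℝ≥0) (s : S) (m : ℕ) :
    1 - (P (m * t) s s).toReal ≤ m * (1 - (P t s s).toReal) := by
  induction m with
  | zero => simp [h.zero]
  | succ m ih =>
    have := h.one_sub_diag_add_le (m * t) t s
    push_cast
    rw [add_mul (m : ℝ≥0), one_mul]
    linarith

/-- The function `t ↦ 1 - P t s s` is subadditive, so it is at most `m` times its value at `t / m`;
letting `m → ∞` brings in the derivative at `0`. -/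
theorem one_sub_diag_le (h : IsTransitionFunction G P) (t : ℝ≥0) (s : S) :
    1 - (P t s s).toReal ≤ -G s s * t := by
  rcases eq_or_ne t 0 with rfl | ht
  · simp [h.zero]
  have ht0 : 0 < t := pos_iff_ne_zero.mpr ht
  have hlim : Tendsto (fun m : ℕ => t / ((m : ℝ≥0) + 1)) atTop (𝓝[>] 0) := by
    rw [tendsto_nhdsWithin_iff]
    refine ⟨?_, Eventually.of_forall fun m => ?_⟩
    · rw [← NNReal.tendsto_coe]
      push_cast
      have := tendsto_one_div_add_atTop_nhds_zero_nat.const_mul (t : ℝ)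
      simpa [div_eq_mul_inv] using this
    · exact div_pos ht0 (by positivity)
  have h1 := ((h.deriv_zero s s).comp hlim).neg.mul_const (t : ℝ)
  refine ge_of_tendsto h1 (Eventually.of_forall fun m => ?_)
  have h2 := h.one_sub_diag_nsmul_le (t / ((m : ℝ≥0) + 1)) s (m + 1)
  have h3 : (((m + 1 : ℕ) : ℝ≥0)) * (t / ((m : ℝ≥0) + 1)) = t := by
    push_cast
    field_simp
  rw [h3] at h2
  refine h2.trans (le_of_eq ?_)
  have ht' : (0 : ℝ) < t := by exact_mod_cast ht0
  simp only [Function.comp, if_true]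
  push_cast
  field_simp
  ring

open Classical in
theorem abs_sub_le (h : IsTransitionFunction G P) (t : ℝ≥0) (s s' : S) :
    |(P t s s').toReal - if s = s' then 1 else 0| ≤ -G s s * t := by
  have h1 := h.one_sub_diag_le t s
  split_ifs with hs
  · subst hs
    rw [abs_sub_comm, abs_of_nonneg (by linarith [(P t s).toReal_le_one s])]
    exact h1
  · rw [sub_zero, abs_of_nonneg ENNReal.toReal_nonneg]
    have h2 : (P t s s).toReal + (P t s s').toReal ≤ 1 := by
      have := sum_le_hasSum {s, s'} (fun i _ => ENNReal.toReal_nonneg) (P t s).hasSum_toReal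
      rwa [Finset.sum_pair hs] at this
    linarith

/-- Stationarity makes the `π`-average of the difference quotients of `P` vanish for every `t > 0`.
The quotients are bounded by `Λ` uniformly in the starting state, so dominated convergence allows `t
→ 0`. -/
theorem global_balance (h : IsTransitionFunction G P) {π : PMF S} (hπ : ∀ t, π.bind (P t) = π)
    {Λ : ℝ} (hΛ : ∀ s, -G s s ≤ Λ) (s' : S) : ∑' s, (π s).toReal * G s s' = 0 := by
  classical
  have hlim : Tendsto (fun t : ℝ≥0 => ∑' s, (π s).toReal *
      (((P t s s').toReal - if s = s' then 1 else 0) / (t : ℝ))) (𝓝[>] 0)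
      (𝓝 (∑' s, (π s).toReal * G s s')) := by
    refine tendsto_tsum_of_dominated_convergence (bound := fun s => (π s).toReal * Λ)
      (π.hasSum_toReal.summable.mul_right Λ) (fun s => ?_) ?_
    · have := (h.deriv_zero s s').const_mul (π s).toReal
      convert this
    · filter_upwards [self_mem_nhdsWithin] with t ht s
      have ht' : (0 : ℝ) < t := by exact_mod_cast ht
      rw [norm_mul, Real.norm_eq_abs, Real.norm_eq_abs, abs_of_nonneg ENNReal.toReal_nonneg,
        abs_div, abs_of_pos ht']
      refine mul_le_mul_of_nonneg_left ?_ ENNReal.toReal_nonneg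
      rw [div_le_iff₀ ht']
      have h1 := h.abs_sub_le t s s'
      have h2 := mul_le_mul_of_nonneg_right (hΛ s) ht'.le
      refine le_trans (le_of_eq ?_) (h1.trans h2)
      congr!
  refine tendsto_nhds_unique hlim ?_
  refine tendsto_const_nhds.congr' ?_
  filter_upwards [self_mem_nhdsWithin] with t ht
  have h1 : HasSum (fun s => (π s).toReal * (P t s s').toReal) (π s').toReal := by
    have h2 : π s' = ∑' s, π s * P t s s' := by rw [← PMF.bind_apply, hπ]
    have h3 := ENNReal.hasSum_toReal (f := fun s => π s * P t s s')
      (by rw [← h2]; exact π.apply_ne_top s')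
    have h4 := ENNReal.tsum_toReal_eq (f := fun s => π s * P t s s')
      (fun s => ENNReal.mul_ne_top (π.apply_ne_top s) ((P t s).apply_ne_top s'))
    rw [← h4, ← h2] at h3
    simpa [ENNReal.toReal_mul] using h3
  have h5 : HasSum (fun s => (π s).toReal * if s = s' then (1 : ℝ) else 0) (π s').toReal := by
    have := hasSum_ite_eq s' (π s').toReal
    convert this using 1
    funext s
    split_ifs with hs <;> simp [hs]
  have h6 := (h1.sub h5).div_const (t : ℝ)
  rw [sub_self, zero_div] at h6
  refine (HasSum.tsum_eq ?_).symm
  refine (congrArg (fun g : S → ℝ => HasSum g 0) (funext fun s => ?_)).mpr h6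
  ring

end IsTransitionFunction
end MultiserverJob
end TransitionFunction

/-! ### The generator on functions of the job counts -/

namespace MultiserverJob
namespace Policy
open MeasureTheory

section Drift

variable {I : ℕ} {n : ℕ} {ell : Fin I → ℕ} {S : Type*}

/-- The generator applied to the function `F` of the numbers of jobs in the system. -/
noncomputable def drift (pol : Policy n ell S) (lam mu : Fin I → ℝ) (F : (Fin I → ℕ) → ℝ)
    (s : S) : ℝ :=
  (∑ i, lam i * (F (pol.X s + Pi.single i 1) - F (pol.X s)))
    + ∑ i, mu i * (pol.Z s i : ℝ) * (F (pol.X s - Pi.single i 1) - F (pol.X s))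

/-- Total transition rate out of a state, counting the transitions that do not change it. -/
noncomputable def exitRate (pol : Policy n ell S) (lam mu : Fin I → ℝ) (s : S) : ℝ :=
  (∑ i, lam i) + (∑ i, mu i * (pol.Z s i : ℝ)) + pol.clockRate

variable {pol : Policy n ell S} {lam mu : Fin I → ℝ}

theorem ell_mul_Z_le (s : S) (i : Fin I) : ell i * pol.Z s i ≤ n :=
  (Finset.single_le_sum (f := fun i => ell i * pol.Z s i) (fun _ _ => Nat.zero_le _)
    (Finset.mem_univ i)).trans (pol.capacity s)

theorem Z_le (hell : ∀ i, 1 ≤ ell i) (s : S) (i : Fin I) : (pol.Z s i : ℝ) ≤ n := by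
  exact_mod_cast (Nat.le_mul_of_pos_left _ (hell i)).trans (pol.ell_mul_Z_le s i)

theorem hasSum_rate_mul (F : (Fin I → ℕ) → ℝ) (s : S) :
    HasSum (fun s' => pol.rate lam mu s s' * F (pol.X s'))
      (pol.drift lam mu F s + pol.exitRate lam mu s * F (pol.X s)) := by
  have h1 : ∀ i, HasSum (fun s' => lam i * ((pol.arrival i s s').toReal * F (pol.X s')))
      (lam i * F (pol.X s + Pi.single i 1)) := fun i =>
    (PMF.hasSum_toReal_mul _ _ _ fun s' hs' => by rw [pol.arrival_X i s s' hs']).mul_left _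
  have h2 : ∀ i, HasSum (fun s' => mu i * (pol.Z s i : ℝ) *
      ((pol.departure i s s').toReal * F (pol.X s')))
      (mu i * (pol.Z s i : ℝ) * F (pol.X s - Pi.single i 1)) := by
    intro i
    rcases Nat.eq_zero_or_pos (pol.Z s i) with hz | hz
    · simp [hz]
    · refine (PMF.hasSum_toReal_mul _ _ _ fun s' hs' => ?_).mul_left _
      rw [← pol.departure_X i s hz s' hs', add_tsub_cancel_right]
  have h3 : HasSum (fun s' => (pol.clockRate : ℝ) * ((pol.reschedule s s').toReal * F (pol.X s')))
      ((pol.clockRate : ℝ) * F (pol.X s)) :=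
    (PMF.hasSum_toReal_mul _ _ _ fun s' hs' => by rw [pol.reschedule_X s s' hs']).mul_left _
  have h4 := ((hasSum_sum fun i (_ : i ∈ Finset.univ) => h1 i).add
    (hasSum_sum fun i (_ : i ∈ Finset.univ) => h2 i)).add h3
  convert h4 using 1
  · simp only [rate, add_mul, Finset.sum_mul, mul_assoc]
  · simp only [drift, exitRate, mul_sub, Finset.sum_sub_distrib, add_mul, Finset.sum_mul]
    ring

theorem hasSum_rate (s : S) : HasSum (pol.rate lam mu s) (pol.exitRate lam mu s) := by
  simpa [drift] using pol.hasSum_rate_mul (lam := lam) (mu := mu) (fun _ => 1) s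

theorem rate_nonneg (hlam : ∀ i, 0 ≤ lam i) (hmu : ∀ i, 0 < mu i) (s s' : S) :
    0 ≤ pol.rate lam mu s s' := by
  have h1 : ∀ i, 0 ≤ lam i * (pol.arrival i s s').toReal := fun i =>
    mul_nonneg (hlam i) ENNReal.toReal_nonneg
  have h2 : ∀ i, 0 ≤ mu i * (pol.Z s i : ℝ) * (pol.departure i s s').toReal := fun i =>
    mul_nonneg (mul_nonneg (hmu i).le (Nat.cast_nonneg _)) ENNReal.toReal_nonneg
  exact add_nonneg (add_nonneg (Finset.sum_nonneg fun i _ => h1 i)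
    (Finset.sum_nonneg fun i _ => h2 i)) (mul_nonneg pol.clockRate.2 ENNReal.toReal_nonneg)

theorem exitRate_nonneg (hlam : ∀ i, 0 ≤ lam i) (hmu : ∀ i, 0 < mu i) (s : S) :
    0 ≤ pol.exitRate lam mu s :=
  (pol.hasSum_rate s).nonneg (pol.rate_nonneg hlam hmu s)

theorem exists_exitRate_le (hmu : ∀ i, 0 < mu i) (hell : ∀ i, 1 ≤ ell i) :
    ∃ Λ, ∀ s, pol.exitRate lam mu s ≤ Λ := by
  refine ⟨(∑ i, lam i) + (∑ i, mu i * n) + pol.clockRate, fun s => ?_⟩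
  have : ∑ i, mu i * (pol.Z s i : ℝ) ≤ ∑ i, mu i * n :=
    Finset.sum_le_sum fun i _ => mul_le_mul_of_nonneg_left (Z_le hell s i) (hmu i).le
  simp only [exitRate]
  linarith

theorem neg_generator_diag_le (hlam : ∀ i, 0 ≤ lam i) (hmu : ∀ i, 0 < mu i) (s : S) :
    -pol.generator lam mu s s ≤ pol.exitRate lam mu s := by
  have h1 := pol.rate_nonneg hlam hmu s s
  have h2 := (pol.hasSum_rate (lam := lam) (mu := mu) s).tsum_eq
  simp only [generator, if_true]
  linarith

theorem hasSum_generator_mul (F : (Fin I → ℕ) → ℝ) (s : S) :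
    HasSum (fun s' => pol.generator lam mu s s' * F (pol.X s')) (pol.drift lam mu F s) := by
  classical
  have h1 := pol.hasSum_rate_mul (lam := lam) (mu := mu) F s
  have h2 : HasSum (fun s' => if s' = s then pol.exitRate lam mu s * F (pol.X s) else 0)
      (pol.exitRate lam mu s * F (pol.X s)) := hasSum_ite_eq s _
  have h3 := h1.sub h2
  rw [add_sub_cancel_right] at h3
  refine (congrArg (fun g : S → ℝ => HasSum g _) (funext fun s' => ?_)).mpr h3
  rw [generator, (pol.hasSum_rate (lam := lam) (mu := mu) s).tsum_eq]
  rcases eq_or_ne s s' with rfl | hs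
  · simp [sub_mul]
  · simp [hs, hs.symm]

theorem abs_generator_le (hlam : ∀ i, 0 ≤ lam i) (hmu : ∀ i, 0 < mu i) (s s' : S) [Decidable (s' = s)] :
    |pol.generator lam mu s s'| ≤
      pol.rate lam mu s s' + if s' = s then pol.exitRate lam mu s else 0 := by
  have h1 := pol.rate_nonneg hlam hmu s s'
  have h2 := pol.exitRate_nonneg hlam hmu s
  rw [generator, (pol.hasSum_rate (lam := lam) (mu := mu) s).tsum_eq]
  rcases eq_or_ne s s' with rfl | hs
  · simp only [if_true]
    rw [abs_le]
    constructor <;> linarith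
  · simp [hs, hs.symm, abs_of_nonneg h1]

/-- Global balance is integrated against `F`; bounded exit rates and bounded `F` give the absolute
summability needed to exchange the two sums. -/
theorem tsum_drift_eq_zero (hlam : ∀ i, 0 ≤ lam i) (hmu : ∀ i, 0 < mu i) (hell : ∀ i, 1 ≤ ell i)
    {π : PMF S} (hπ : pol.IsSteadyState lam mu π) {F : (Fin I → ℕ) → ℝ} {C : ℝ}
    (hF : ∀ x, |F x| ≤ C) : ∑' s, (π s).toReal * pol.drift lam mu F s = 0 := by
  classical
  obtain ⟨P, hP, hst⟩ := hπ
  obtain ⟨Λ, hΛ⟩ := pol.exists_exitRate_le (lam := lam) hmu hell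
  have hsum : ∀ s, HasSum (fun s' => (π s).toReal * (pol.rate lam mu s s' +
      if s' = s then pol.exitRate lam mu s else 0))
      ((π s).toReal * (pol.exitRate lam mu s + pol.exitRate lam mu s)) := fun s =>
    ((pol.hasSum_rate s).add (hasSum_ite_eq s _)).mul_left _
  have hsummable : Summable (fun p : S × S => (π p.1).toReal * (pol.rate lam mu p.1 p.2 +
      if p.2 = p.1 then pol.exitRate lam mu p.1 else 0)) := by
    rw [summable_prod_of_nonneg]
    · refine ⟨fun s => (hsum s).summable, ?_⟩
      simp only [(hsum _).tsum_eq]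
      refine Summable.of_nonneg_of_le (fun s => ?_) (fun s => ?_)
        (π.hasSum_toReal.summable.mul_right (Λ + Λ))
      · have := pol.exitRate_nonneg hlam hmu s
        exact mul_nonneg ENNReal.toReal_nonneg (by linarith)
      · exact mul_le_mul_of_nonneg_left (by linarith [hΛ s]) ENNReal.toReal_nonneg
    · intro p
      exact mul_nonneg ENNReal.toReal_nonneg
        ((abs_nonneg _).trans (pol.abs_generator_le hlam hmu p.1 p.2))
  have hsummable2 : Summable (Function.uncurry fun s s' =>
      (π s).toReal * (pol.generator lam mu s s' * F (pol.X s'))) := by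
    refine Summable.of_norm_bounded (hsummable.mul_right C) ?_
    rintro ⟨s, s'⟩
    simp only [Function.uncurry_apply_pair, norm_mul, Real.norm_eq_abs]
    rw [abs_of_nonneg ENNReal.toReal_nonneg, ← mul_assoc]
    refine mul_le_mul (mul_le_mul_of_nonneg_left (pol.abs_generator_le hlam hmu s s')
      ENNReal.toReal_nonneg) (hF _) (abs_nonneg _) (mul_nonneg ENNReal.toReal_nonneg
        ((abs_nonneg _).trans (pol.abs_generator_le hlam hmu s s')))
  have h1 : ∀ s, (π s).toReal * pol.drift lam mu F s =
      ∑' s', (π s).toReal * (pol.generator lam mu s s' * F (pol.X s')) := fun s =>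
    ((pol.hasSum_generator_mul F s).mul_left _).tsum_eq.symm
  simp only [h1]
  rw [← hsummable2.tsum_comm]
  have h2 := hP.global_balance hst
    (fun s => (pol.neg_generator_diag_le hlam hmu s).trans (hΛ s))
  have h3 : ∀ s', ∑' s, (π s).toReal * (pol.generator lam mu s s' * F (pol.X s')) = 0 := by
    intro s'
    simp only [← mul_assoc]
    rw [tsum_mul_right, h2, zero_mul]
  simp [h3]

theorem abs_drift_le (hlam : ∀ i, 0 ≤ lam i) (hmu : ∀ i, 0 < mu i) (hell : ∀ i, 1 ≤ ell i)
    {F : (Fin I → ℕ) → ℝ} {K : ℝ} (hF : ∀ x i, |F (x + Pi.single i 1) - F x| ≤ K) (s : S) :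
    |pol.drift lam mu F s| ≤ (∑ i, lam i * K) + ∑ i, mu i * n * K := by
  refine (abs_add_le _ _).trans (add_le_add ?_ ?_)
  · refine (Finset.abs_sum_le_sum_abs _ _).trans (Finset.sum_le_sum fun i _ => ?_)
    rw [abs_mul, abs_of_nonneg (hlam i)]
    exact mul_le_mul_of_nonneg_left (hF _ _) (hlam i)
  · refine (Finset.abs_sum_le_sum_abs _ _).trans (Finset.sum_le_sum fun i _ => ?_)
    have hK : 0 ≤ K := (abs_nonneg _).trans (hF 0 i)
    rw [abs_mul, abs_of_nonneg (mul_nonneg (hmu i).le (Nat.cast_nonneg _))]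
    have h1 : |F (pol.X s - Pi.single i 1) - F (pol.X s)| ≤ K := by
      rcases Nat.eq_zero_or_pos (pol.X s i) with hx | hx
      · have : pol.X s - Pi.single i 1 = pol.X s := by
          funext j
          rcases eq_or_ne j i with rfl | hj
          · simp [hx]
          · simp [hj]
        simpa [this] using hK
      · have : pol.X s - Pi.single i 1 + Pi.single i 1 = pol.X s := by
          funext j
          rcases eq_or_ne j i with rfl | hj
          · simp; omega
          · simp [hj]
        have h := hF (pol.X s - Pi.single i 1) i
        rwa [this, abs_sub_comm] at h
    exact mul_le_mul (mul_le_mul_of_nonneg_left (Z_le hell s i) (hmu i).le) h1 (abs_nonneg _)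
      (mul_nonneg (hmu i).le (Nat.cast_nonneg _))

/-- In steady state the generator applied to a function with bounded increments has mean `0`. -/
theorem integral_drift_eq_zero [Countable S] [MeasurableSpace S] [DiscreteMeasurableSpace S]
    (hlam : ∀ i, 0 ≤ lam i) (hmu : ∀ i, 0 < mu i) (hell : ∀ i, 1 ≤ ell i)
    {π : PMF S} (hπ : pol.IsSteadyState lam mu π) {F : (Fin I → ℕ) → ℝ} {K : ℝ}
    (hF : ∀ x i, |F (x + Pi.single i 1) - F x| ≤ K) :
    ∫ s, pol.drift lam mu F s ∂π.toMeasure = 0 := by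
  -- Clipping `F` to `[-N, N]` makes it bounded without enlarging its increments, so the drifts are
  -- bounded uniformly in `N`.
  set T : ℕ → (Fin I → ℕ) → ℝ := fun N x => max (min (F x) N) (-(N : ℝ)) with hT
  have hTK : ∀ N x i, |T N (x + Pi.single i 1) - T N x| ≤ K := fun N x i =>
    (abs_max_sub_max_le_abs _ _ _).trans ((abs_min_sub_min_le_max _ _ _ _).trans (by
      simpa using hF x i))
  have hTb : ∀ N x, |T N x| ≤ N := by
    intro N x
    have : (0 : ℝ) ≤ N := Nat.cast_nonneg N
    rw [abs_le]
    exact ⟨le_max_right _ _, max_le (min_le_right _ _) (by linarith)⟩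
  have h0 : ∀ N, ∫ s, pol.drift lam mu (T N) s ∂π.toMeasure = 0 := by
    intro N
    rw [PMF.integral_eq_tsum]
    · simpa using pol.tsum_drift_eq_zero hlam hmu hell hπ (hTb N)
    · exact Integrable.of_bound (by fun_prop) _
        (Eventually.of_forall fun s => pol.abs_drift_le hlam hmu hell (hTK N) s)
  have hTlim : ∀ x, Tendsto (fun N => T N x) atTop (𝓝 (F x)) := by
    intro x
    refine tendsto_const_nhds.congr' ?_
    filter_upwards [eventually_ge_atTop ⌈|F x|⌉₊] with N hN
    have h1 : |F x| ≤ N := (Nat.le_ceil _).trans (by exact_mod_cast hN)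
    rw [abs_le] at h1
    simp only [hT]
    rw [min_eq_left h1.2, max_eq_left h1.1]
  refine tendsto_nhds_unique (tendsto_integral_of_dominated_convergence
    (F := fun N s => pol.drift lam mu (T N) s)
    (fun _ => (∑ i, lam i * K) + ∑ i, mu i * n * K) (fun N => by fun_prop)
    (integrable_const _) (fun N => Eventually.of_forall fun s =>
      pol.abs_drift_le hlam hmu hell (hTK N) s) (Eventually.of_forall fun s => ?_)) ?_
  · refine Tendsto.add (tendsto_finsetSum _ fun i _ => ?_) (tendsto_finsetSum _ fun i _ => ?_)
    · exact ((hTlim _).sub (hTlim _)).const_mul _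
    · exact ((hTlim _).sub (hTlim _)).const_mul _
  · simp only [h0]
    exact tendsto_const_nhds

end Drift
end Policy
end MultiserverJob

/-! ### Elementary inequalities for the test functions -/

section RealInequalities

/-- The function `w ↦ w ^ 2`, continued linearly to the right of `M`. -/
noncomputable def huber (M w : ℝ) : ℝ := w ^ 2 - max (w - M) 0 ^ 2

/-- `huber M` has derivative `2 * min w M` for all `w`, and this derivative is `2`-Lipschitz from
above: a second-order Taylor bound. -/
theorem huber_add_le (M w d : ℝ) : huber M (w + d) ≤ huber M w + 2 * min w M * d + d ^ 2 := by
  unfold huber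
  rcases le_total w M with h | h
  · rw [min_eq_left h, max_eq_right (sub_nonpos.mpr h)]
    nlinarith [sq_nonneg (max (w + d - M) 0)]
  · rw [min_eq_right h, max_eq_left (sub_nonneg.mpr h)]
    rcases le_total (w + d - M) 0 with h2 | h2
    · rw [max_eq_right h2]
      nlinarith
    · rw [max_eq_left h2]
      nlinarith

theorem abs_huber_add_sub_le {M : ℝ} (hM : 0 ≤ M) {w d : ℝ} (hw : 0 ≤ w) (hd : 0 ≤ d) :
    |huber M (w + d) - huber M w| ≤ 2 * M * d + d ^ 2 := by
  have h1 := huber_add_le M w d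
  have h2 := huber_add_le M (w + d) (-d)
  rw [add_neg_cancel_right] at h2
  have h3 : min w M * d ≤ M * d := mul_le_mul_of_nonneg_right (min_le_right _ _) hd
  have h4 : 0 ≤ min (w + d) M * d := mul_nonneg (le_min (by linarith) hM) hd
  have h5 : 0 ≤ M * d := mul_nonneg hM hd
  rw [abs_le]
  constructor <;> nlinarith

theorem posPart_pow_four_drift_le {ρ v : ℝ} (hρ : 1 ≤ ρ) :
    ρ * (max (v - 1) 0 ^ 4 - max v 0 ^ 4) + (ρ - v) * (max (v + 1) 0 ^ 4 - max v 0 ^ 4)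
      ≤ 20 * ρ ^ 2 - 2 * max v 0 ^ 4 := by
  rcases le_total 0 v with h | h
  · have h1 : max (v - 1) 0 ^ 4 ≤ (v - 1) ^ 4 := by
      rcases le_total 0 (v - 1) with h2 | h2
      · rw [max_eq_left h2]
      · rw [max_eq_right h2, zero_pow four_ne_zero]
        positivity
    rw [max_eq_left h, max_eq_left (by linarith : 0 ≤ v + 1)]
    have h3 : ρ * (max (v - 1) 0 ^ 4 - v ^ 4) ≤ ρ * ((v - 1) ^ 4 - v ^ 4) :=
      mul_le_mul_of_nonneg_left (by linarith) (by linarith)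
    have h4 : 0 ≤ v ^ 3 := by positivity
    -- Expanding, the leading terms are `12 ρ v² + 2 ρ - 4 v⁴`. The square gives `12 ρ v² ≤ 2 v⁴ +
    -- 18 ρ²`, and `2 ρ ≤ 2 ρ²` supplies the rest of the constant `20`.
    nlinarith [sq_nonneg (v ^ 2 - 3 * ρ), sq_nonneg v, mul_nonneg h h]
  · rw [max_eq_right h, max_eq_right (by linarith : v - 1 ≤ 0)]
    rcases le_total 0 (v + 1) with h2 | h2
    · rw [max_eq_left h2]
      have h3 : (v + 1) ^ 4 ≤ 1 := pow_le_one₀ h2 (by linarith)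
      have h4 : (ρ - v) * (v + 1) ^ 4 ≤ (ρ - v) * 1 := mul_le_mul_of_nonneg_left h3 (by linarith)
      nlinarith
    · rw [max_eq_right h2]
      nlinarith

end RealInequalities

/-! ### Steady-state moments from three test functions -/

namespace MultiserverJob
namespace Policy
open MeasureTheory

section Moments

variable {I : ℕ} {n : ℕ} {ell : Fin I → ℕ} {S : Type*}
variable {pol : Policy n ell S} {lam mu : Fin I → ℝ}

theorem X_pos_of_Z_ne_zero {s : S} {i : Fin I} (h : pol.Z s i ≠ 0) : 1 ≤ pol.X s i :=
  (Nat.one_le_iff_ne_zero.mpr h).trans (pol.Z_le_X s i)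

theorem drift_apply (f : ℕ → ℝ) (i : Fin I) (s : S) :
    pol.drift lam mu (fun x => f (x i)) s =
      lam i * (f (pol.X s i + 1) - f (pol.X s i))
        + mu i * (pol.Z s i : ℝ) * (f (pol.X s i - 1) - f (pol.X s i)) := by
  unfold drift
  congr 1
  · rw [Finset.sum_eq_single i]
    · simp
    · intro j _ hj
      simp [hj.symm]
    · simp
  · rw [Finset.sum_eq_single i]
    · simp
    · intro j _ hj
      simp [hj.symm]
    · simp

theorem abs_apply_add_single_sub_le {f : ℕ → ℝ} {K : ℝ} (hf : ∀ m, |f (m + 1) - f m| ≤ K)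
    (i : Fin I) (x : Fin I → ℕ) (j : Fin I) :
    |f ((x + Pi.single j 1 : Fin I → ℕ) i) - f (x i)| ≤ K := by
  rcases eq_or_ne i j with rfl | hj
  · simpa using hf (x i)
  · simpa [hj] using (abs_nonneg _).trans (hf 0)

/-- Work `∑ i, (ℓ i / μ i) * x i` brought by the jobs that are counted by `x`. -/
noncomputable def work (ell : Fin I → ℕ) (mu : Fin I → ℝ) (x : Fin I → ℕ) : ℝ :=
  ∑ i, (ell i : ℝ) / mu i * (x i : ℝ)

theorem work_add_single (x : Fin I → ℕ) (i : Fin I) :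
    work ell mu (x + Pi.single i 1) = work ell mu x + (ell i : ℝ) / mu i := by
  unfold work
  simp only [Pi.add_apply, Nat.cast_add, mul_add, Finset.sum_add_distrib]
  congr 1
  rw [Finset.sum_eq_single i]
  · simp
  · intro j _ hj
    simp [hj]
  · simp

theorem work_nonneg (hmu : ∀ i, 0 < mu i) (x : Fin I → ℕ) : 0 ≤ work ell mu x :=
  Finset.sum_nonneg fun i _ => by have := hmu i; positivity

theorem work_sub_single {s : S} {i : Fin I} (h : pol.Z s i ≠ 0) :
    work ell mu (pol.X s - Pi.single i 1) = work ell mu (pol.X s) + -((ell i : ℝ) / mu i) := by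
  have h1 : pol.X s - Pi.single i 1 + Pi.single i 1 = pol.X s := by
    have := pol.X_pos_of_Z_ne_zero h
    funext j
    rcases eq_or_ne j i with rfl | hj
    · simpa using Nat.sub_add_cancel this
    · simp [hj]
  have h2 := work_add_single (ell := ell) (mu := mu) (pol.X s - Pi.single i 1) i
  rw [h1] at h2
  linarith

/-- Number of busy servers minus its mean. -/
noncomputable def busyDev (pol : Policy n ell S) (lam mu : Fin I → ℝ) (s : S) : ℝ :=
  (∑ i, (ell i : ℝ) * (pol.Z s i : ℝ)) - ∑ i, lam i * (ell i : ℝ) / mu i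

theorem abs_busyDev_le (hlam : ∀ i, 0 ≤ lam i) (hmu : ∀ i, 0 < mu i) (s : S) :
    |pol.busyDev lam mu s| ≤ n + ∑ i, lam i * (ell i : ℝ) / mu i := by
  have h1 : (∑ i, (ell i : ℝ) * (pol.Z s i : ℝ)) ≤ n := by exact_mod_cast pol.capacity s
  have h2 : (0 : ℝ) ≤ ∑ i, (ell i : ℝ) * (pol.Z s i : ℝ) := by positivity
  have h3 : 0 ≤ ∑ i, lam i * (ell i : ℝ) / mu i := Finset.sum_nonneg fun i _ => by
    have := hmu i; have := hlam i; positivity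
  unfold busyDev
  rw [abs_le]
  constructor <;> linarith

variable [Countable S] [MeasurableSpace S] [DiscreteMeasurableSpace S]

theorem integrable_of_abs_le {P : Measure S} [IsProbabilityMeasure P] {f : S → ℝ} {C : ℝ}
    (h : ∀ s, |f s| ≤ C) : Integrable f P :=
  Integrable.of_bound (by fun_prop) C (Eventually.of_forall h)

theorem integrable_Z (hell : ∀ i, 1 ≤ ell i) {π : PMF S} (i : Fin I) :
    Integrable (fun s => (pol.Z s i : ℝ)) π.toMeasure :=
  integrable_of_abs_le (C := n) fun s => by
    rw [abs_of_nonneg (Nat.cast_nonneg _)]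
    exact Z_le hell s i

/-- Rate conservation: the test function is the number of type `i` jobs. -/
theorem integral_Z (hlam : ∀ i, 0 ≤ lam i) (hmu : ∀ i, 0 < mu i) (hell : ∀ i, 1 ≤ ell i)
    {π : PMF S} (hπ : pol.IsSteadyState lam mu π) (i : Fin I) :
    ∫ s, (pol.Z s i : ℝ) ∂π.toMeasure = lam i / mu i := by
  have h := pol.integral_drift_eq_zero hlam hmu hell hπ (F := fun x => (x i : ℝ)) (K := 1)
    (abs_apply_add_single_sub_le (f := fun m => (m : ℝ)) (fun m => by simp) i)
  have h1 : ∀ s, pol.drift lam mu (fun x => (x i : ℝ)) s = lam i - mu i * (pol.Z s i : ℝ) := by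
    intro s
    rw [pol.drift_apply (fun m => (m : ℝ))]
    rcases eq_or_ne (pol.Z s i) 0 with hz | hz
    · simp [hz]
    · have := pol.X_pos_of_Z_ne_zero hz
      push_cast [Nat.cast_sub this]
      ring
  simp only [h1] at h
  rw [integral_sub (integrable_const _) ((integrable_Z hell i).const_mul _), integral_const_mul] at h
  simp only [integral_const, probReal_univ, smul_eq_mul, one_mul] at h
  rw [eq_div_iff (hmu i).ne']
  linarith

theorem integral_busyDev (hlam : ∀ i, 0 ≤ lam i) (hmu : ∀ i, 0 < mu i) (hell : ∀ i, 1 ≤ ell i)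
    {π : PMF S} (hπ : pol.IsSteadyState lam mu π) :
    ∫ s, pol.busyDev lam mu s ∂π.toMeasure = 0 := by
  unfold busyDev
  rw [integral_sub (integrable_finsetSum _ fun i _ => (integrable_Z hell i).const_mul _)
    (integrable_const _), integral_finsetSum _ fun i _ => (integrable_Z hell i).const_mul _]
  simp only [integral_const_mul, pol.integral_Z hlam hmu hell hπ, integral_const, probReal_univ,
    smul_eq_mul, one_mul]
  rw [sub_eq_zero]
  exact Finset.sum_congr rfl fun i _ => by ring

/-- The test function is `huber M` of the work. Its first-order drift is `-2 * min W M * D`; the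
second-order terms from arrivals and from departures each have mean `σ²`, the latter because `Z i`
has mean `λ i / μ i`. -/
theorem integral_min_work_mul_busyDev_le (hlam : ∀ i, 0 ≤ lam i) (hmu : ∀ i, 0 < mu i)
    (hell : ∀ i, 1 ≤ ell i) {π : PMF S} (hπ : pol.IsSteadyState lam mu π) {M : ℝ} (hM : 0 ≤ M) :
    ∫ s, min (work ell mu (pol.X s)) M * pol.busyDev lam mu s ∂π.toMeasure
      ≤ workVariability lam mu ell := by
  set a : Fin I → ℝ := fun i => (ell i : ℝ) / mu i with ha
  have ha0 : ∀ i, 0 ≤ a i := fun i => by have := hmu i; positivity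
  have hinc : ∀ (x : Fin I → ℕ) i, |huber M (work ell mu (x + Pi.single i 1)) -
      huber M (work ell mu x)| ≤ ∑ i, (2 * M * a i + a i ^ 2) := fun x i => by
    rw [work_add_single]
    refine (abs_huber_add_sub_le hM (work_nonneg hmu x) (ha0 i)).trans ?_
    exact Finset.single_le_sum (f := fun i => 2 * M * a i + a i ^ 2)
      (fun j _ => by have := ha0 j; positivity) (Finset.mem_univ i)
  have h0 := pol.integral_drift_eq_zero hlam hmu hell hπ (F := fun x => huber M (work ell mu x)) hinc
  have hpt : ∀ s, pol.drift lam mu (fun x => huber M (work ell mu x)) s ≤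
      -2 * (min (work ell mu (pol.X s)) M * pol.busyDev lam mu s) +
        ((∑ i, lam i * a i ^ 2) + ∑ i, mu i * a i ^ 2 * (pol.Z s i : ℝ)) := by
    intro s
    set m := min (work ell mu (pol.X s)) M
    have h1 : pol.drift lam mu (fun x => huber M (work ell mu x)) s ≤
        (∑ i, lam i * (2 * m * a i + a i ^ 2)) +
          ∑ i, mu i * (pol.Z s i : ℝ) * (2 * m * -a i + a i ^ 2) := by
      refine add_le_add (Finset.sum_le_sum fun i _ => ?_) (Finset.sum_le_sum fun i _ => ?_)
      · refine mul_le_mul_of_nonneg_left ?_ (hlam i)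
        beta_reduce
        rw [work_add_single]
        have := huber_add_le M (work ell mu (pol.X s)) (a i)
        linarith
      · rcases eq_or_ne (pol.Z s i) 0 with hz | hz
        · simp [hz]
        · refine mul_le_mul_of_nonneg_left ?_ (mul_nonneg (hmu i).le (Nat.cast_nonneg _))
          beta_reduce
          rw [pol.work_sub_single hz]
          have := huber_add_le M (work ell mu (pol.X s)) (-a i)
          rw [neg_sq] at this
          linarith
    refine h1.trans (le_of_eq ?_)
    unfold busyDev
    simp only [mul_sub, Finset.mul_sum, ← Finset.sum_add_distrib, ← Finset.sum_sub_distrib]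
    refine Finset.sum_congr rfl fun i _ => ?_
    have := (hmu i).ne'
    simp only [ha]
    field_simp
    ring
  have hint1 : Integrable (fun s => min (work ell mu (pol.X s)) M * pol.busyDev lam mu s)
      π.toMeasure := integrable_of_abs_le (C := M * (n + ∑ i, lam i * (ell i : ℝ) / mu i))
    fun s => by
      rw [abs_mul, abs_of_nonneg (le_min (work_nonneg hmu _) hM)]
      exact mul_le_mul (min_le_right _ _) (pol.abs_busyDev_le hlam hmu s) (abs_nonneg _) hM
  have hint2 : Integrable (fun s => ∑ i, mu i * a i ^ 2 * (pol.Z s i : ℝ)) π.toMeasure :=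
    integrable_finsetSum _ fun i _ => (integrable_Z hell i).const_mul _
  have hint3 : Integrable (fun s => (∑ i, lam i * a i ^ 2) +
      ∑ i, mu i * a i ^ 2 * (pol.Z s i : ℝ)) π.toMeasure := (integrable_const _).add hint2
  have h2 := integral_mono (μ := π.toMeasure)
    (integrable_of_abs_le (pol.abs_drift_le hlam hmu hell hinc))
    ((hint1.const_mul (-2)).add hint3) hpt
  rw [h0] at h2
  simp only [Pi.add_apply] at h2
  rw [integral_add (hint1.const_mul (-2)) hint3, integral_const_mul,
    integral_add (integrable_const _) hint2,
    integral_finsetSum _ fun i _ => (integrable_Z hell i).const_mul _] at h2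
  simp only [integral_const_mul, pol.integral_Z hlam hmu hell hπ, integral_const, probReal_univ,
    smul_eq_mul, one_mul] at h2
  have h3 : ∑ i, lam i * a i ^ 2 = workVariability lam mu ell :=
    Finset.sum_congr rfl fun i _ => by simp only [ha]; ring
  have h4 : ∑ i, mu i * a i ^ 2 * (lam i / mu i) = workVariability lam mu ell :=
    Finset.sum_congr rfl fun i _ => by
      have := (hmu i).ne'
      simp only [ha]; field_simp
  rw [h3, h4] at h2
  linarith

/-- At most `X i` jobs are in service and the test function decreases in `X i`, so its drift is at
most that in the infinite-server system, whatever the policy. There, with `ρ = λ i / μ i`,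
fluctuations are of order `√ρ`. -/
theorem integral_posPart_pow_four_le (hlam : ∀ i, 0 ≤ lam i) (hmu : ∀ i, 0 < mu i)
    (hell : ∀ i, 1 ≤ ell i) {π : PMF S} (hπ : pol.IsSteadyState lam mu π) (i : Fin I) :
    ∫ s, max (lam i / mu i - (pol.X s i : ℝ)) 0 ^ 4 ∂π.toMeasure ≤ 10 * (lam i / mu i) ^ 2 := by
  set ρ := lam i / mu i with hρ
  have hρ0 : 0 ≤ ρ := div_nonneg (hlam i) (hmu i).le
  set f : ℕ → ℝ := fun m => max (ρ - (m : ℝ)) 0 ^ 4 with hf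
  have hf0 : ∀ m, 0 ≤ f m := fun m => by positivity
  have hf1 : ∀ m, f m ≤ ρ ^ 4 := fun m =>
    pow_le_pow_left₀ (le_max_right _ _) (max_le (by linarith [Nat.cast_nonneg (α := ℝ) m]) hρ0) 4
  have hint : Integrable (fun s => f (pol.X s i)) π.toMeasure :=
    integrable_of_abs_le (C := ρ ^ 4) fun s => by rw [abs_of_nonneg (hf0 _)]; exact hf1 _
  change ∫ s, f (pol.X s i) ∂π.toMeasure ≤ _
  -- For `ρ ≤ 1` the trivial bound `ρ ^ 4 ≤ ρ ^ 2` suffices; the drift inequality needs `ρ ≥ 1`.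
  rcases le_total ρ 1 with h1 | h1
  · have h2 := integral_mono hint (integrable_const (ρ ^ 4)) (fun s => hf1 (pol.X s i))
    simp only [integral_const, probReal_univ, smul_eq_mul, one_mul] at h2
    have h3 : ρ ^ 4 ≤ ρ ^ 2 := pow_le_pow_of_le_one hρ0 h1 (by norm_num)
    nlinarith [sq_nonneg ρ]
  · have hinc : ∀ m, |f (m + 1) - f m| ≤ ρ ^ 4 := fun m => by
      rw [abs_le]
      constructor <;> linarith [hf0 m, hf1 m, hf0 (m + 1), hf1 (m + 1)]
    have h0 := pol.integral_drift_eq_zero hlam hmu hell hπ (F := fun x => f (x i))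
      (abs_apply_add_single_sub_le hinc i)
    have hpt : ∀ s, pol.drift lam mu (fun x => f (x i)) s ≤
        mu i * (20 * ρ ^ 2) - mu i * 2 * f (pol.X s i) := by
      intro s
      rw [pol.drift_apply]
      have hx : (0 : ℝ) ≤ (pol.X s i : ℝ) := Nat.cast_nonneg _
      have h2 := posPart_pow_four_drift_le (v := ρ - (pol.X s i : ℝ)) h1
      have h3 : lam i = mu i * ρ := by
        rw [hρ]; field_simp [(hmu i).ne']
      set g : ℝ := max (ρ - (pol.X s i : ℝ) + 1) 0 ^ 4 with hg
      have h4 : f (pol.X s i + 1) = max (ρ - (pol.X s i : ℝ) - 1) 0 ^ 4 := by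
        simp only [hf]; push_cast; ring_nf
      have h5 : f (pol.X s i) ≤ g :=
        pow_le_pow_left₀ (le_max_right _ _) (max_le_max (by linarith) le_rfl) 4
      have h6 : (pol.Z s i : ℝ) * (f (pol.X s i - 1) - f (pol.X s i)) ≤
          (pol.X s i : ℝ) * (g - f (pol.X s i)) := by
        rcases eq_or_ne (pol.Z s i) 0 with hz | hz
        · rw [hz, Nat.cast_zero, zero_mul]
          exact mul_nonneg hx (by linarith)
        · have h7 := pol.X_pos_of_Z_ne_zero hz
          have h8 : f (pol.X s i - 1) = g := by
            simp only [hf, hg]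
            push_cast [Nat.cast_sub h7]
            ring_nf
          rw [h8]
          exact mul_le_mul_of_nonneg_right (by exact_mod_cast pol.Z_le_X s i) (by linarith)
      have h9 : ρ * (f (pol.X s i + 1) - f (pol.X s i)) +
          (pol.Z s i : ℝ) * (f (pol.X s i - 1) - f (pol.X s i)) ≤
          20 * ρ ^ 2 - 2 * f (pol.X s i) := by
        rw [h4]
        have h10 : ρ - (ρ - (pol.X s i : ℝ)) = (pol.X s i : ℝ) := by ring
        rw [h10] at h2
        change _ ≤ 20 * ρ ^ 2 - 2 * max (ρ - (pol.X s i : ℝ)) 0 ^ 4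
        refine le_trans ?_ h2
        exact add_le_add le_rfl h6
      have h11 := mul_le_mul_of_nonneg_left h9 (hmu i).le
      rw [h3]
      linarith
    have h2 := integral_mono (μ := π.toMeasure)
      (integrable_of_abs_le (pol.abs_drift_le hlam hmu hell (abs_apply_add_single_sub_le hinc i)))
      ((integrable_const _).sub (hint.const_mul (mu i * 2))) hpt
    rw [h0] at h2
    simp only [Pi.sub_apply] at h2
    rw [integral_sub (integrable_const _) (hint.const_mul _)] at h2
    simp only [integral_const_mul, integral_const, probReal_univ, smul_eq_mul, one_mul] at h2
    have h3 : mu i * (∫ s, f (pol.X s i) ∂π.toMeasure) ≤ mu i * (10 * ρ ^ 2) := by linarith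
    exact le_of_mul_le_mul_left h3 (hmu i)

end Moments
end Policy
end MultiserverJob

/-! ### The drift method in abstract form -/

section DriftMethod
open MeasureTheory

variable {Ω : Type*} [MeasurableSpace Ω] {P : Measure Ω} [IsProbabilityMeasure P]
  {D U E H g q Z : Ω → ℝ} {k κ A T δ γ v h : ℝ}

theorem integral_posPart_le_of_integral_eq_zero (hD : Integrable D P) (hδ : ∀ s, D s ≤ δ)
    (hδ0 : 0 ≤ δ) : ∫ s, max (D s) 0 ∂P ≤ δ := by
  have := integral_mono (μ := P) hD.pos_part (integrable_const δ) fun s => max_le (hδ s) hδ0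
  simpa using this

/-- This bounds the mean `d` of `D⁺` without reference to `δ`. On `D ≥ 0` the product `U D` is at
least `k D²`; on `D < 0` its negative part is controlled by `T D⁻`, whose mean is `T d` because `D`
has mean `0`. -/
theorem sq_integral_posPart_le (hD : Integrable D P) (hH : Integrable H P)
    (hUD : Integrable (fun s => U s * D s) P) (hED : Integrable (fun s => E s * D s) P)
    (hk : 0 < k) (hκ : 0 ≤ κ)
    (hD0 : ∫ s, D s ∂P = 0) (hU : ∫ s, U s * D s ∂P ≤ v + κ * ∫ s, E s * D s ∂P)
    (hE0 : ∀ s, 0 ≤ E s) (hEH : ∀ s, E s ^ 2 ≤ H s)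
    (hpos : ∀ s, 0 ≤ D s → k * D s ≤ U s)
    (hneg : ∀ s, D s < 0 → A * T * D s - A * H s ≤ U s * D s) (hA : 0 ≤ A)
    (hHh : ∫ s, H s ∂P ≤ h) :
    k / 2 * (∫ s, max (D s) 0 ∂P) ^ 2 ≤
      v + A * T * (∫ s, max (D s) 0 ∂P) + (A + κ ^ 2 / (2 * k)) * h := by
  set d := ∫ s, max (D s) 0 ∂P with hd
  -- Half of `k D²` absorbs `κ E D` by Young's inequality; the other half is replaced by its tangent
  -- line at `d`, so that no second moment of `D` is integrated.
  have hpt : ∀ s, k * d * max (D s) 0 - A * T * (max (D s) 0 - D s) -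
      (A + κ ^ 2 / (2 * k)) * H s - k / 2 * d ^ 2 ≤ U s * D s - κ * (E s * D s) := by
    intro s
    have h1 := hE0 s
    have h2 := hEH s
    have h3 : 0 ≤ H s := (sq_nonneg _).trans h2
    have h4 : 0 ≤ κ ^ 2 / (2 * k) := by positivity
    rcases le_or_gt 0 (D s) with h5 | h5
    · rw [max_eq_left h5]
      have h6 := mul_le_mul_of_nonneg_right (hpos s h5) h5
      have h7 : κ * (E s * D s) ≤ k / 2 * D s ^ 2 + κ ^ 2 / (2 * k) * E s ^ 2 := by
        have h8 : k / 2 * D s ^ 2 + κ ^ 2 / (2 * k) * E s ^ 2 - κ * (E s * D s) =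
            (k * D s - κ * E s) ^ 2 / (2 * k) := by field_simp; ring
        have h9 : 0 ≤ (k * D s - κ * E s) ^ 2 / (2 * k) := by positivity
        linarith
      have h8 := mul_le_mul_of_nonneg_left h2 h4
      have h9 := mul_nonneg hA h3
      have h10 := mul_nonneg hk.le (sq_nonneg (D s - d))
      nlinarith
    · rw [max_eq_right h5.le]
      have h6 := hneg s h5
      have h7 := mul_nonneg h4 h3
      have h8 : 0 ≤ -(κ * (E s * D s)) := by
        have := mul_nonneg hκ (mul_nonneg h1 (neg_nonneg.mpr h5.le))
        linarith
      have h9 : 0 ≤ k / 2 * d ^ 2 := by positivity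
      linarith
  have i1 : Integrable (fun s => A * T * (max (D s) 0 - D s)) P :=
    (hD.pos_part.sub hD).const_mul (A * T)
  have i2 : Integrable (fun s => k * d * max (D s) 0 - A * T * (max (D s) 0 - D s)) P :=
    (hD.pos_part.const_mul (k * d)).sub i1
  have i3 : Integrable (fun s => k * d * max (D s) 0 - A * T * (max (D s) 0 - D s) -
      (A + κ ^ 2 / (2 * k)) * H s) P := i2.sub (hH.const_mul _)
  have hmono := integral_mono (i3.sub (integrable_const (k / 2 * d ^ 2))) (hUD.sub (hED.const_mul κ)) hpt
  have e1 : ∫ s, (k * d * max (D s) 0 - A * T * (max (D s) 0 - D s) -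
      (A + κ ^ 2 / (2 * k)) * H s - k / 2 * d ^ 2) ∂P =
      k * d * d - A * T * (d - 0) - (A + κ ^ 2 / (2 * k)) * (∫ s, H s ∂P) - k / 2 * d ^ 2 := by
    rw [integral_sub i3 (integrable_const _), integral_sub i2 (hH.const_mul _),
      integral_sub (hD.pos_part.const_mul (k * d)) i1,
      integral_const_mul, integral_const_mul, integral_const_mul, integral_sub hD.pos_part hD, hD0]
    simp [hd]
  have e2 : ∫ s, (U s * D s - κ * (E s * D s)) ∂P =
      (∫ s, U s * D s ∂P) - κ * ∫ s, E s * D s ∂P := by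
    rw [integral_sub hUD (hED.const_mul κ), integral_const_mul]
  have h1 : (A + κ ^ 2 / (2 * k)) * (∫ s, H s ∂P) ≤ (A + κ ^ 2 / (2 * k)) * h :=
    mul_le_mul_of_nonneg_left hHh (by positivity)
  have h2 := (e1.symm.trans_le hmono).trans_eq e2
  nlinarith

/-- Here `g` is the indicator of the states with a possible queue, where `D ≥ γ`, so that `γ g U ≤ U
D` on `D ≥ 0`. Since `Z` has mean `0`, replacing `-g Z` by `-Z` costs only the mean of `(1 - g) Z`.
-/
theorem mul_integral_le_of_drift (hD : Integrable D P) (hH : Integrable H P)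
    (hE : Integrable E P) (hZ : Integrable Z P) (hq : Integrable q P)
    (hgU : Integrable (fun s => g s * U s) P)
    (hUD : Integrable (fun s => U s * D s) P) (hED : Integrable (fun s => E s * D s) P)
    (hk : 0 < k) (hκ : 0 ≤ κ) (hγ : 0 < γ)
    (hD0 : ∫ s, D s ∂P = 0) (hDδ : ∀ s, D s ≤ δ)
    (hU : ∫ s, U s * D s ∂P ≤ v + κ * ∫ s, E s * D s ∂P)
    (hE0 : ∀ s, 0 ≤ E s) (hEH : ∀ s, E s ^ 2 ≤ H s)
    (hpos : ∀ s, 0 ≤ D s → k * D s ≤ U s)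
    (hneg : ∀ s, D s < 0 → A * T * D s - A * H s ≤ U s * D s) (hA : 0 ≤ A)
    (hHh : ∫ s, H s ∂P ≤ h)
    (hg : ∀ s, g s = 0 ∨ (g s = 1 ∧ γ ≤ D s))
    (hqU : ∀ s, q s ≤ g s * (U s - Z s)) (hZ0 : ∫ s, Z s ∂P = 0)
    (hgZ : ∀ s, (1 - g s) * Z s ≤ A * (max (D s) 0 + T + E s)) :
    γ * ∫ s, q s ∂P ≤ v + A * T * (∫ s, max (D s) 0 ∂P) + (A + κ) * h
      + κ * δ * (∫ s, max (D s) 0 ∂P)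
      + γ * (A * ((∫ s, max (D s) 0 ∂P) + T + ∫ s, E s ∂P)) := by
  set d := ∫ s, max (D s) 0 ∂P with hd
  have hpt : ∀ s, γ * (g s * U s) - A * T * (max (D s) 0 - D s) - (A + κ) * H s
      - κ * δ * max (D s) 0 ≤ U s * D s - κ * (E s * D s) := by
    intro s
    have h1 := hE0 s
    have h2 := hEH s
    have h3 : 0 ≤ H s := (sq_nonneg _).trans h2
    rcases le_or_gt 0 (D s) with h5 | h5
    · rw [max_eq_left h5]
      have h6 : 0 ≤ U s := (mul_nonneg hk.le h5).trans (hpos s h5)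
      have h7 : γ * (g s * U s) ≤ U s * D s := by
        rcases hg s with h8 | ⟨h8, h9⟩
        · rw [h8]
          nlinarith [mul_nonneg h6 h5]
        · rw [h8]
          nlinarith [mul_le_mul_of_nonneg_right h9 h6]
      have h8 : E s * D s ≤ H s + δ * D s := by
        nlinarith [sq_nonneg (E s - D s), mul_le_mul_of_nonneg_right (hDδ s) h5]
      have h9 := mul_le_mul_of_nonneg_left h8 hκ
      have h10 := mul_nonneg hA h3
      nlinarith
    · rw [max_eq_right h5.le]
      have h6 := hneg s h5
      have h7 : g s = 0 := (hg s).resolve_right fun h => by linarith [h.2]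
      have h8 : 0 ≤ -(κ * (E s * D s)) := by
        have := mul_nonneg hκ (mul_nonneg h1 (neg_nonneg.mpr h5.le))
        linarith
      have h9 := mul_nonneg hκ h3
      rw [h7]
      nlinarith
  have i1 : Integrable (fun s => A * T * (max (D s) 0 - D s)) P :=
    (hD.pos_part.sub hD).const_mul (A * T)
  have i2 : Integrable (fun s => γ * (g s * U s) - A * T * (max (D s) 0 - D s)) P :=
    (hgU.const_mul γ).sub i1
  have i3 : Integrable (fun s => γ * (g s * U s) - A * T * (max (D s) 0 - D s) -
      (A + κ) * H s) P := i2.sub (hH.const_mul _)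
  have hmono := integral_mono (i3.sub (hD.pos_part.const_mul (κ * δ))) (hUD.sub (hED.const_mul κ)) hpt
  have e1 : ∫ s, (γ * (g s * U s) - A * T * (max (D s) 0 - D s) - (A + κ) * H s
      - κ * δ * max (D s) 0) ∂P =
      γ * (∫ s, g s * U s ∂P) - A * T * (d - 0) - (A + κ) * (∫ s, H s ∂P) - κ * δ * d := by
    rw [integral_sub i3 (hD.pos_part.const_mul (κ * δ)), integral_sub i2 (hH.const_mul _),
      integral_sub (hgU.const_mul γ) i1,
      integral_const_mul, integral_const_mul, integral_const_mul, integral_const_mul,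
      integral_sub hD.pos_part hD, hD0]
  have e2 : ∫ s, (U s * D s - κ * (E s * D s)) ∂P =
      (∫ s, U s * D s ∂P) - κ * ∫ s, E s * D s ∂P := by
    rw [integral_sub hUD (hED.const_mul κ), integral_const_mul]
  have h1 : (A + κ) * (∫ s, H s ∂P) ≤ (A + κ) * h :=
    mul_le_mul_of_nonneg_left hHh (by positivity)
  have h2 := (e1.symm.trans_le hmono).trans_eq e2
  have hpt2 : ∀ s, q s ≤ g s * U s - Z s + A * (max (D s) 0 + T + E s) := by
    intro s
    have h3 := hqU s
    have h4 := hgZ s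
    linarith
  have hTint1 : Integrable (fun s => max (D s) 0 + T) P := hD.pos_part.add (integrable_const T)
  have hTint : Integrable (fun s => A * (max (D s) 0 + T + E s)) P :=
    (hTint1.add hE).const_mul A
  have hgUZ : Integrable (fun s => g s * U s - Z s) P := hgU.sub hZ
  have hmono2 := integral_mono hq (hgUZ.add hTint) hpt2
  have e3 : ∫ s, (g s * U s - Z s + A * (max (D s) 0 + T + E s)) ∂P =
      (∫ s, g s * U s ∂P) - 0 + A * (d + T + ∫ s, E s ∂P) := by
    rw [integral_add hgUZ hTint, integral_sub hgU hZ, hZ0, integral_const_mul,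
      integral_add hTint1 hE, integral_add hD.pos_part (integrable_const T)]
    simp [hd]
  have h5 := mul_le_mul_of_nonneg_left (hmono2.trans_eq e3) hγ.le
  nlinarith

end DriftMethod

/-! ### The shortfall below the infinite-server means -/

namespace MultiserverJob

section Shortfall

variable {I : ℕ} {ell : Fin I → ℕ} {lam mu : Fin I → ℝ}

/-- Server need of the jobs by which the numbers `x` fall short of their means `λ i / μ i` in the
system with infinitely many servers. -/
noncomputable def shortfall (ell : Fin I → ℕ) (lam mu : Fin I → ℝ) (x : Fin I → ℕ) : ℝ :=
  ∑ i, (ell i : ℝ) * max (lam i / mu i - (x i : ℝ)) 0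

theorem shortfall_nonneg (x : Fin I → ℕ) : 0 ≤ shortfall ell lam mu x :=
  Finset.sum_nonneg fun _ _ => mul_nonneg (Nat.cast_nonneg _) (le_max_right _ _)

theorem shortfall_le (hlam : ∀ i, 0 ≤ lam i) (hmu : ∀ i, 0 < mu i) (x : Fin I → ℕ) :
    shortfall ell lam mu x ≤ ∑ i, (ell i : ℝ) * (lam i / mu i) :=
  Finset.sum_le_sum fun i _ => mul_le_mul_of_nonneg_left
    (max_le (by linarith [Nat.cast_nonneg (α := ℝ) (x i)]) (div_nonneg (hlam i) (hmu i).le))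
    (Nat.cast_nonneg _)

theorem mul_sub_add_shortfall_nonneg (x : Fin I → ℕ) (i : Fin I) :
    0 ≤ (ell i : ℝ) * ((x i : ℝ) - lam i / mu i) + shortfall ell lam mu x := by
  have h1 := Finset.single_le_sum (f := fun i => (ell i : ℝ) * max (lam i / mu i - (x i : ℝ)) 0)
    (fun _ _ => mul_nonneg (Nat.cast_nonneg _) (le_max_right _ _)) (Finset.mem_univ i)
  have h2 : (ell i : ℝ) * (lam i / mu i - (x i : ℝ)) ≤
      (ell i : ℝ) * max (lam i / mu i - (x i : ℝ)) 0 :=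
    mul_le_mul_of_nonneg_left (le_max_left _ _) (Nat.cast_nonneg _)
  have h3 : shortfall ell lam mu x = ∑ i, (ell i : ℝ) * max (lam i / mu i - (x i : ℝ)) 0 := rfl
  linarith

theorem neg_shortfall_le (x : Fin I → ℕ) :
    -shortfall ell lam mu x ≤ ∑ i, (ell i : ℝ) * ((x i : ℝ) - lam i / mu i) := by
  unfold shortfall
  rw [← Finset.sum_neg_distrib]
  refine Finset.sum_le_sum fun i _ => ?_
  have h2 : (ell i : ℝ) * (lam i / mu i - (x i : ℝ)) ≤
      (ell i : ℝ) * max (lam i / mu i - (x i : ℝ)) 0 :=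
    mul_le_mul_of_nonneg_left (le_max_left _ _) (Nat.cast_nonneg _)
  linarith

theorem shortfall_pow_four_le (x : Fin I → ℕ) :
    shortfall ell lam mu x ^ 4 ≤
      (I : ℝ) ^ 3 * ∑ i, (ell i : ℝ) ^ 4 * max (lam i / mu i - (x i : ℝ)) 0 ^ 4 := by
  set f : Fin I → ℝ := fun i => (ell i : ℝ) * max (lam i / mu i - (x i : ℝ)) 0
  have h1 : (∑ i, f i) ^ 2 ≤ I * ∑ i, f i ^ 2 := by
    simpa using sq_sum_le_card_mul_sum_sq (s := Finset.univ) (f := f)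
  have h2 : (∑ i, f i ^ 2) ^ 2 ≤ I * ∑ i, (f i ^ 2) ^ 2 := by
    simpa using sq_sum_le_card_mul_sum_sq (s := Finset.univ) (f := fun i => f i ^ 2)
  calc (∑ i, f i) ^ 4 = ((∑ i, f i) ^ 2) ^ 2 := by ring
    _ ≤ (I * ∑ i, f i ^ 2) ^ 2 := pow_le_pow_left₀ (sq_nonneg _) h1 2
    _ = (I : ℝ) ^ 2 * (∑ i, f i ^ 2) ^ 2 := by ring
    _ ≤ (I : ℝ) ^ 2 * (I * ∑ i, (f i ^ 2) ^ 2) := mul_le_mul_of_nonneg_left h2 (sq_nonneg _)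
    _ = (I : ℝ) ^ 3 * ∑ i, (f i ^ 2) ^ 2 := by ring
    _ = _ := by
      congr 1
      exact Finset.sum_congr rfl fun i _ => by ring

/-- Where `V > T`, each factor `V / T` exceeds `1`. The case `T = 0` is harmless: then `V = 0`, and
division by zero gives `0`. -/
theorem excess_sq_le {V T : ℝ} (hT : 0 ≤ T) (h0 : T = 0 → V = 0) :
    max (V - T) 0 ^ 2 ≤ V ^ 4 / T ^ 2 := by
  rcases le_or_gt V T with h | h
  · rw [max_eq_right (by linarith), zero_pow two_ne_zero]
    positivity
  · have hT' : 0 < T := lt_of_le_of_ne hT fun hT0 => by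
      rw [h0 hT0.symm] at h
      linarith
    rw [max_eq_left (by linarith), le_div_iff₀ (by positivity)]
    calc (V - T) ^ 2 * T ^ 2 ≤ V ^ 2 * V ^ 2 := by gcongr; linarith
      _ = V ^ 4 := by ring

theorem mul_excess_le {V T : ℝ} (hV : 0 ≤ V) (hT : 0 ≤ T) (h0 : T = 0 → V = 0) :
    T * max (V - T) 0 ≤ V ^ 4 / T ^ 2 := by
  rcases le_or_gt V T with h | h
  · rw [max_eq_right (by linarith), mul_zero]
    positivity
  · have hT' : 0 < T := lt_of_le_of_ne hT fun hT0 => by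
      rw [h0 hT0.symm] at h
      linarith
    rw [max_eq_left (by linarith), le_div_iff₀ (by positivity)]
    calc T * (V - T) * T ^ 2 ≤ V * V * V ^ 2 := by gcongr; linarith
      _ = V ^ 4 := by ring

theorem sq_mul_div_le_workVariability (hlam : ∀ i, 0 ≤ lam i) (hmu : ∀ i, 0 < mu i) {k : ℝ}
    (hk : 0 < k) (hkmu : ∀ i, k ≤ 1 / mu i) (i : Fin I) :
    (ell i : ℝ) ^ 2 * (lam i / mu i) ≤ workVariability lam mu ell / k := by
  have h0 : ∀ i, 0 ≤ lam i * (ell i : ℝ) ^ 2 / mu i ^ 2 := fun i => by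
    have := hlam i; positivity
  have h1 : lam i * (ell i : ℝ) ^ 2 / mu i ^ 2 ≤ workVariability lam mu ell :=
    Finset.single_le_sum (f := fun i => lam i * (ell i : ℝ) ^ 2 / mu i ^ 2)
      (fun i _ => h0 i) (Finset.mem_univ i)
  rw [le_div_iff₀ hk]
  refine le_trans ?_ h1
  have h2 : 0 ≤ (ell i : ℝ) ^ 2 * (lam i / mu i) := by
    have := hlam i; have := hmu i; positivity
  refine (mul_le_mul_of_nonneg_left (hkmu i) h2).trans (le_of_eq ?_)
  have := (hmu i).ne'
  field_simp

theorem workVariability_nonneg (hlam : ∀ i, 0 ≤ lam i) : 0 ≤ workVariability lam mu ell :=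
  Finset.sum_nonneg fun i _ => by have := hlam i; positivity

theorem shortfall_eq_zero (hlam : ∀ i, 0 ≤ lam i) (hmu : ∀ i, 0 < mu i) (hell : ∀ i, 1 ≤ ell i)
    (h : workVariability lam mu ell = 0) (x : Fin I → ℕ) : shortfall ell lam mu x = 0 := by
  have h0 : ∀ i, lam i * (ell i : ℝ) ^ 2 / mu i ^ 2 = 0 := fun i =>
    (Finset.sum_eq_zero_iff_of_nonneg fun i _ => by have := hlam i; positivity).mp h i
      (Finset.mem_univ i)
  have h1 : ∀ i, lam i = 0 := fun i => by
    have h2 := h0 i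
    have h3 : (ell i : ℝ) ≠ 0 := by exact_mod_cast (Nat.one_le_iff_ne_zero.mp (hell i))
    simpa [h3, (hmu i).ne'] using h2
  refine Finset.sum_eq_zero fun i _ => ?_
  rw [h1 i, zero_div, zero_sub, max_eq_right (by simp), mul_zero]

end Shortfall

/-! ### Consequences of work conservation; comparison of work and server need -/

namespace Policy
open MeasureTheory

section WorkConserving

variable {I : ℕ} {n : ℕ} {ell : Fin I → ℕ} {S : Type*}
variable {pol : Policy n ell S} {lam mu : Fin I → ℝ}

theorem X_eq_Z_of_busy_lt (hell : ∀ i, 1 ≤ ell i) {δ' : ℝ} (hwc : pol.WorkConserving δ') {s : S}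
    (h : ∑ i, (ell i : ℝ) * (pol.Z s i : ℝ) < n - δ') : pol.X s = pol.Z s := by
  have h1 : ∑ i, (ell i : ℝ) * (pol.X s i : ℝ) ≤ ∑ i, (ell i : ℝ) * (pol.Z s i : ℝ) :=
    (min_le_iff.mp (hwc s)).resolve_right (not_le.mpr h)
  have h2 : ∀ i ∈ Finset.univ, (ell i : ℝ) * (pol.Z s i : ℝ) ≤ (ell i : ℝ) * (pol.X s i : ℝ) :=
    fun i _ => mul_le_mul_of_nonneg_left (by exact_mod_cast pol.Z_le_X s i) (Nat.cast_nonneg _)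
  have h3 := (Finset.sum_eq_sum_iff_of_le h2).mp (le_antisymm (Finset.sum_le_sum h2) h1)
  funext i
  have h4 : (ell i : ℝ) ≠ 0 := by exact_mod_cast (Nat.one_le_iff_ne_zero.mp (hell i))
  have h5 := mul_left_cancel₀ h4 (h3 i (Finset.mem_univ i))
  exact_mod_cast h5.symm

theorem workload_nonneg (hmu : ∀ i, 0 < mu i) (s : S) : 0 ≤ pol.workload mu s :=
  Finset.sum_nonneg fun i _ => by
    have := hmu i
    have : (pol.Z s i : ℝ) ≤ pol.X s i := by exact_mod_cast pol.Z_le_X s i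
    exact mul_nonneg (by positivity) (by linarith)

theorem workload_eq (s : S) :
    pol.workload mu s = work ell mu (pol.X s) - work ell mu (pol.Z s) := by
  simp only [workload, work, mul_sub, Finset.sum_sub_distrib]

theorem busyDev_le_slack (s : S) : pol.busyDev lam mu s ≤ slack n lam mu ell := by
  have h1 : (∑ i, (ell i : ℝ) * (pol.Z s i : ℝ)) ≤ n := by exact_mod_cast pol.capacity s
  unfold busyDev slack
  linarith

theorem busyDev_eq (s : S) : pol.busyDev lam mu s =
    ∑ i, (ell i : ℝ) * ((pol.Z s i : ℝ) - lam i / mu i) := by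
  simp only [busyDev, mul_sub, Finset.sum_sub_distrib]
  congr 1
  exact Finset.sum_congr rfl fun i _ => by ring

theorem busyDev_le_sum_X (s : S) : pol.busyDev lam mu s ≤
    ∑ i, (ell i : ℝ) * ((pol.X s i : ℝ) - lam i / mu i) := by
  rw [busyDev_eq]
  refine Finset.sum_le_sum fun i _ => mul_le_mul_of_nonneg_left ?_ (Nat.cast_nonneg _)
  have : (pol.Z s i : ℝ) ≤ pol.X s i := by exact_mod_cast pol.Z_le_X s i
  linarith

theorem work_sub_add_eq (x : Fin I → ℕ) (R : ℝ) :
    work ell mu x - (∑ i, (ell i : ℝ) / mu i * (lam i / mu i)) + (∑ i, 1 / mu i) * R =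
      ∑ i, ((ell i : ℝ) * ((x i : ℝ) - lam i / mu i) + R) * (1 / mu i) := by
  simp only [work, Finset.sum_mul, ← Finset.sum_sub_distrib, ← Finset.sum_add_distrib]
  exact Finset.sum_congr rfl fun i _ => by ring

/-- Adding `R` to each `ℓ i (x i - λ i / μ i)` makes every summand nonnegative, so the weights `1 /
μ i` can be compared termwise with a common constant. The same device gives `work_le_mul_sum`. -/
theorem mul_sum_le_work {k : ℝ} (hk : 0 ≤ k) (hkmu : ∀ i, k ≤ 1 / mu i) (x : Fin I → ℕ) {R : ℝ}
    (hR : shortfall ell lam mu x ≤ R) :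
    k * ∑ i, (ell i : ℝ) * ((x i : ℝ) - lam i / mu i) ≤
      work ell mu x - (∑ i, (ell i : ℝ) / mu i * (lam i / mu i)) + (∑ i, 1 / mu i) * R := by
  rw [work_sub_add_eq, Finset.mul_sum]
  refine Finset.sum_le_sum fun i _ => ?_
  have h1 := mul_sub_add_shortfall_nonneg (ell := ell) (lam := lam) (mu := mu) x i
  have h2 := mul_le_mul_of_nonneg_left (hkmu i)
    (by linarith : 0 ≤ (ell i : ℝ) * ((x i : ℝ) - lam i / mu i) + R)
  have h3 : 0 ≤ R := (shortfall_nonneg x).trans hR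
  nlinarith

theorem work_le_mul_sum {K : ℝ} (hKmu : ∀ i, 1 / mu i ≤ K) (x : Fin I → ℕ) {R : ℝ}
    (hR : shortfall ell lam mu x ≤ R) :
    work ell mu x - (∑ i, (ell i : ℝ) / mu i * (lam i / mu i)) + (∑ i, 1 / mu i) * R ≤
      K * ((∑ i, (ell i : ℝ) * ((x i : ℝ) - lam i / mu i)) + I * R) := by
  have h0 : K * ((∑ i, (ell i : ℝ) * ((x i : ℝ) - lam i / mu i)) + I * R) =
      ∑ i, ((ell i : ℝ) * ((x i : ℝ) - lam i / mu i) + R) * K := by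
    rw [← Finset.sum_mul, Finset.sum_add_distrib]
    simp
    ring
  rw [work_sub_add_eq, h0]
  refine Finset.sum_le_sum fun i _ => ?_
  have h1 := mul_sub_add_shortfall_nonneg (ell := ell) (lam := lam) (mu := mu) x i
  exact mul_le_mul_of_nonneg_left (hKmu i) (by linarith)

theorem work_Z_le {K : ℝ} (hK : 0 ≤ K) (hKmu : ∀ i, 1 / mu i ≤ K) (s : S) :
    work ell mu (pol.Z s) ≤ K * n := by
  have h1 : (∑ i, (ell i : ℝ) * (pol.Z s i : ℝ)) ≤ n := by exact_mod_cast pol.capacity s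
  refine le_trans ?_ (mul_le_mul_of_nonneg_left h1 hK)
  rw [Finset.mul_sum]
  refine Finset.sum_le_sum fun i _ => ?_
  have h2 := mul_le_mul_of_nonneg_right (hKmu i)
    (by positivity : 0 ≤ (ell i : ℝ) * (pol.Z s i : ℝ))
  refine le_trans (le_of_eq ?_) h2
  ring

end WorkConserving
end Policy
end MultiserverJob

/-! ### The drift method applied to the truncated workload -/

namespace MultiserverJob
namespace Policy
open MeasureTheory

section TruncatedWorkload

variable {I : ℕ} {n : ℕ} {ell : Fin I → ℕ} {S : Type*}
variable {pol : Policy n ell S} {lam mu : Fin I → ℝ}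
variable [Countable S] [MeasurableSpace S] [DiscreteMeasurableSpace S]

theorem integral_shortfall_pow_four_le (hlam : ∀ i, 0 ≤ lam i) (hmu : ∀ i, 0 < mu i)
    (hell : ∀ i, 1 ≤ ell i) {π : PMF S} (hπ : pol.IsSteadyState lam mu π) {k : ℝ}
    (hk : 0 < k) (hkmu : ∀ i, k ≤ 1 / mu i) :
    ∫ s, shortfall ell lam mu (pol.X s) ^ 4 ∂π.toMeasure ≤
      10 * (I : ℝ) ^ 4 / k ^ 2 * workVariability lam mu ell ^ 2 := by
  set v := workVariability lam mu ell with hv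
  have hint1 : ∀ i, Integrable (fun s => max (lam i / mu i - (pol.X s i : ℝ)) 0 ^ 4)
      π.toMeasure := fun i => integrable_of_abs_le (C := (lam i / mu i) ^ 4) fun s => by
    have h0 : 0 ≤ lam i / mu i := div_nonneg (hlam i) (hmu i).le
    rw [abs_of_nonneg (by positivity)]
    exact pow_le_pow_left₀ (le_max_right _ _)
      (max_le (by linarith [Nat.cast_nonneg (α := ℝ) (pol.X s i)]) h0) 4
  have hint2 : Integrable (fun s => ∑ i, (ell i : ℝ) ^ 4 *
      max (lam i / mu i - (pol.X s i : ℝ)) 0 ^ 4) π.toMeasure :=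
    integrable_finsetSum _ fun i _ => (hint1 i).const_mul _
  have hint3 : Integrable (fun s => shortfall ell lam mu (pol.X s) ^ 4) π.toMeasure :=
    integrable_of_abs_le (C := (∑ i, (ell i : ℝ) * (lam i / mu i)) ^ 4) fun s => by
      have := shortfall_nonneg (ell := ell) (lam := lam) (mu := mu) (pol.X s)
      rw [abs_of_nonneg (by positivity)]
      exact pow_le_pow_left₀ this (shortfall_le hlam hmu _) 4
  refine (integral_mono hint3 (hint2.const_mul ((I : ℝ) ^ 3)) fun s =>
    shortfall_pow_four_le (pol.X s)).trans ?_
  rw [integral_const_mul, integral_finsetSum _ fun i _ => (hint1 i).const_mul _]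
  simp only [integral_const_mul]
  have h1 : ∀ i ∈ Finset.univ, (ell i : ℝ) ^ 4 *
      ∫ s, max (lam i / mu i - (pol.X s i : ℝ)) 0 ^ 4 ∂π.toMeasure ≤ 10 * (v / k) ^ 2 := by
    intro i _
    have h2 := mul_le_mul_of_nonneg_left (pol.integral_posPart_pow_four_le hlam hmu hell hπ i)
      (by positivity : (0 : ℝ) ≤ (ell i : ℝ) ^ 4)
    refine h2.trans ?_
    have h3 : 0 ≤ (ell i : ℝ) ^ 2 * (lam i / mu i) :=
      mul_nonneg (sq_nonneg _) (div_nonneg (hlam i) (hmu i).le)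
    have h4 := pow_le_pow_left₀ h3 (sq_mul_div_le_workVariability hlam hmu hk hkmu i) 2
    refine le_trans (le_of_eq ?_) (mul_le_mul_of_nonneg_left h4 (by norm_num : (0 : ℝ) ≤ 10))
    ring
  have h5 := mul_le_mul_of_nonneg_left (Finset.sum_le_sum h1)
    (by positivity : (0 : ℝ) ≤ (I : ℝ) ^ 3)
  refine h5.trans (le_of_eq ?_)
  simp
  ring

/-- Bound on the truncated workload in terms of the mean `d` of the positive part of the deviation
of the number of busy servers, and of the mean `e` of the excess of the shortfall over `T`. -/
theorem exists_mul_integral_min_workload_le (hlam : ∀ i, 0 ≤ lam i) (hmu : ∀ i, 0 < mu i)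
    (hell : ∀ i, 1 ≤ ell i) {π : PMF S} (hπ : pol.IsSteadyState lam mu π) {δ' : ℝ}
    (hwc : pol.WorkConserving δ') (hδ' : 0 ≤ δ') (hδ : δ' < slack n lam mu ell)
    {k K T A h : ℝ} (hk : 0 < k) (hkmu : ∀ i, k ≤ 1 / mu i) (hK : 0 ≤ K)
    (hKmu : ∀ i, 1 / mu i ≤ K) (hT : 0 ≤ T) (hT0 : T = 0 → workVariability lam mu ell = 0)
    (hA : A = 2 * K * (I + 1))
    (hh : h = 10 * (I : ℝ) ^ 4 / k ^ 2 * workVariability lam mu ell ^ 2 / T ^ 2) :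
    ∃ d e : ℝ, 0 ≤ d ∧ d ≤ slack n lam mu ell ∧ 0 ≤ e ∧ T * e ≤ h ∧ (T = 0 → e = 0) ∧
      k / 2 * d ^ 2 ≤ workVariability lam mu ell + A * T * d
        + (A + (∑ i, 1 / mu i) ^ 2 / (2 * k)) * h ∧
      ∃ N₀ : ℝ, ∀ N, N₀ ≤ N →
        (slack n lam mu ell - δ') * ∫ s, min (pol.workload mu s) N ∂π.toMeasure ≤
          workVariability lam mu ell + A * T * d + (A + ∑ i, 1 / mu i) * h
            + (∑ i, 1 / mu i) * slack n lam mu ell * d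
            + (slack n lam mu ell - δ') * (A * (d + T + e)) := by
  set v := workVariability lam mu ell with hv
  set δ := slack n lam mu ell with hδdef
  set κ := ∑ i, 1 / mu i with hκdef
  set c := ∑ i, (ell i : ℝ) / mu i * (lam i / mu i) with hc
  have hκ : 0 ≤ κ := Finset.sum_nonneg fun i _ => by have := hmu i; positivity
  have hc0 : 0 ≤ c := Finset.sum_nonneg fun i _ => by
    have := hmu i; have := hlam i; positivity
  have hA0 : 0 ≤ A := by rw [hA]; positivity
  have hKA : K ≤ A := by
    rw [hA]; nlinarith [mul_nonneg hK (Nat.cast_nonneg (α := ℝ) I)]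
  have hKI0 : 0 ≤ K * I := mul_nonneg hK (Nat.cast_nonneg _)
  have hKIA2 : 2 * (K * I) ≤ A := by rw [hA]; linarith
  have hKIA : K * I ≤ A := by linarith
  set D : S → ℝ := pol.busyDev lam mu with hDdef
  set V : S → ℝ := fun s => shortfall ell lam mu (pol.X s) with hVdef
  set E : S → ℝ := fun s => max (V s - T) 0 with hEdef
  set H : S → ℝ := fun s => V s ^ 4 / T ^ 2 with hHdef
  set Z : S → ℝ := fun s => work ell mu (pol.Z s) - c with hZdef
  set B := ∑ i, (ell i : ℝ) * (lam i / mu i) with hB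
  have hV0 : ∀ s, 0 ≤ V s := fun s => shortfall_nonneg _
  have hVB : ∀ s, V s ≤ B := fun s => shortfall_le hlam hmu _
  have hVT : T = 0 → ∀ s, V s = 0 := fun h s => shortfall_eq_zero hlam hmu hell (hT0 h) _
  have hE0 : ∀ s, 0 ≤ E s := fun s => le_max_right _ _
  have hEB : ∀ s, E s ≤ B := fun s =>
    max_le (by linarith [hVB s]) ((hV0 s).trans (hVB s))
  have hEH : ∀ s, E s ^ 2 ≤ H s := fun s => excess_sq_le hT fun h => hVT h s
  have hTEH : ∀ s, T * E s ≤ H s := fun s => mul_excess_le (hV0 s) hT fun h => hVT h s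
  have hVR : ∀ s, V s ≤ T + E s := fun s => by linarith [le_max_left (V s - T) 0]
  have hDδ : ∀ s, D s ≤ δ := fun s => pol.busyDev_le_slack s
  have hDC := pol.abs_busyDev_le hlam hmu
  set CD := (n : ℝ) + ∑ i, lam i * (ell i : ℝ) / mu i
  have iD : Integrable D π.toMeasure := integrable_of_abs_le hDC
  have iH : Integrable H π.toMeasure := integrable_of_abs_le (C := B ^ 4 / T ^ 2) fun s => by
    have := hV0 s
    rw [abs_of_nonneg (by positivity)]
    exact div_le_div_of_nonneg_right (pow_le_pow_left₀ this (hVB s) 4) (sq_nonneg _)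
  have iE : Integrable E π.toMeasure := integrable_of_abs_le (C := B) fun s => by
    rw [abs_of_nonneg (hE0 s)]; exact hEB s
  have iED : Integrable (fun s => E s * D s) π.toMeasure :=
    integrable_of_abs_le (C := B * CD) fun s => by
      rw [abs_mul, abs_of_nonneg (hE0 s)]
      exact mul_le_mul (hEB s) (hDC s) (abs_nonneg _) ((hV0 s).trans (hVB s))
  have iW : Integrable (fun s => work ell mu (pol.Z s)) π.toMeasure :=
    integrable_finsetSum _ fun i _ => (integrable_Z hell i).const_mul _
  have iZ : Integrable Z π.toMeasure := iW.sub (integrable_const c)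
  have hZ0 : ∫ s, Z s ∂π.toMeasure = 0 := by
    rw [integral_sub iW (integrable_const c)]
    simp only [work]
    rw [integral_finsetSum _ fun i _ => (integrable_Z hell i).const_mul _]
    simp only [integral_const_mul, pol.integral_Z hlam hmu hell hπ, integral_const, probReal_univ,
      smul_eq_mul, one_mul]
    exact sub_self c
  have hD0 : ∫ s, D s ∂π.toMeasure = 0 := pol.integral_busyDev hlam hmu hell hπ
  have hHh : ∫ s, H s ∂π.toMeasure ≤ h := by
    simp only [hHdef]
    rw [integral_div, hh]
    exact div_le_div_of_nonneg_right
      (pol.integral_shortfall_pow_four_le hlam hmu hell hπ hk hkmu) (sq_nonneg _)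
  have hXZ : ∀ s, D s < δ - δ' → pol.X s = pol.Z s := fun s hs => by
    refine pol.X_eq_Z_of_busy_lt hell hwc ?_
    have h1 : D s = _ - _ := rfl
    have h2 : δ = _ - _ := rfl
    linarith
  have hDeq : ∀ s, D s < δ - δ' →
      D s = ∑ i, (ell i : ℝ) * ((pol.X s i : ℝ) - lam i / mu i) := fun s hs => by
    rw [hXZ s hs]; exact pol.busyDev_eq s
  have hupper : ∀ s, D s < δ - δ' →
      work ell mu (pol.X s) - c + κ * (T + E s) ≤ K * (D s + I * (T + E s)) := fun s hs => by
    rw [hDeq s hs]; exact work_le_mul_sum hKmu _ (hVR s)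
  have hlower : ∀ s, k * D s ≤ work ell mu (pol.X s) - c + κ * (T + E s) := fun s =>
    (mul_le_mul_of_nonneg_left (pol.busyDev_le_sum_X s) hk.le).trans
      (mul_sum_le_work hk.le hkmu _ (hVR s))
  -- Indicator of the states in which a queue is possible.
  set g : S → ℝ := fun s => if D s < δ - δ' then 0 else 1 with hgdef
  have hgZ : ∀ s, (1 - g s) * Z s ≤ A * (max (D s) 0 + T + E s) := by
    intro s
    have h1 : 0 ≤ max (D s) 0 := le_max_right _ _
    have h2 := hE0 s
    by_cases hs : D s < δ - δ'
    · simp only [hgdef, hs, if_true, sub_zero, one_mul]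
      have h3 := hupper s hs
      rw [hXZ s hs] at h3
      have h4 : 0 ≤ κ * (T + E s) := mul_nonneg hκ (by linarith)
      have h5 : K * D s ≤ A * max (D s) 0 :=
        (mul_le_mul_of_nonneg_left (le_max_left _ _) hK).trans (mul_le_mul_of_nonneg_right hKA h1)
      have h6 : K * I * (T + E s) ≤ A * (T + E s) :=
        mul_le_mul_of_nonneg_right hKIA (by linarith)
      simp only [hZdef]
      linarith
    · simp only [hgdef, hs, if_false, sub_self, zero_mul]
      exact mul_nonneg hA0 (by linarith)
  have hg01 : ∀ s, |g s| ≤ 1 := fun s => by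
    simp only [hgdef]; split_ifs <;> simp
  -- Centred truncated work, raised by the correction `κ * (T + E s)` that makes `k * D s ≤ U M s`
  -- hold on `D ≥ 0`.
  set U : ℝ → S → ℝ := fun M s => min (work ell mu (pol.X s)) M - c + κ * (T + E s) with hUdef
  -- Above `K * n` the truncation does not act in states without queue; above `c + k * δ` the lower
  -- bound `k * D s ≤ U M s` survives where it does act.
  set M₁ := max (K * n) (c + k * δ) with hM₁
  have hM₁0 : 0 ≤ M₁ := (mul_nonneg hK (Nat.cast_nonneg n)).trans (le_max_left _ _)
  have hUC : ∀ M, M₁ ≤ M → ∀ s, |U M s| ≤ M + c + κ * (T + B) := by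
    intro M hM s
    have h1 : 0 ≤ min (work ell mu (pol.X s)) M := le_min (work_nonneg hmu _) (hM₁0.trans hM)
    have h2 : κ * (T + E s) ≤ κ * (T + B) := mul_le_mul_of_nonneg_left (by linarith [hEB s]) hκ
    have h3 : 0 ≤ κ * (T + E s) := mul_nonneg hκ (add_nonneg hT (hE0 s))
    simp only [hUdef]
    rw [abs_le]
    constructor <;> linarith [min_le_right (work ell mu (pol.X s)) M]
  have iUD : ∀ M, M₁ ≤ M → Integrable (fun s => U M s * D s) π.toMeasure := fun M hM =>
    integrable_of_abs_le (C := (M + c + κ * (T + B)) * CD) fun s => by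
      rw [abs_mul]
      exact mul_le_mul (hUC M hM s) (hDC s) (abs_nonneg _) ((abs_nonneg _).trans (hUC M hM s))
  have igU : ∀ M, M₁ ≤ M → Integrable (fun s => g s * U M s) π.toMeasure := fun M hM =>
    integrable_of_abs_le (C := 1 * (M + c + κ * (T + B))) fun s => by
      rw [abs_mul]
      exact mul_le_mul (hg01 s) (hUC M hM s) (abs_nonneg _) zero_le_one
  have hU : ∀ M, M₁ ≤ M →
      ∫ s, U M s * D s ∂π.toMeasure ≤ v + κ * ∫ s, E s * D s ∂π.toMeasure := by
    intro M hM
    have h1 := pol.integral_min_work_mul_busyDev_le hlam hmu hell hπ (hM₁0.trans hM)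
    have i1 : Integrable (fun s => (c - κ * T) * D s + -κ * (E s * D s)) π.toMeasure :=
      (iD.const_mul _).add (iED.const_mul _)
    have h2 : ∀ s, min (work ell mu (pol.X s)) M * pol.busyDev lam mu s =
        U M s * D s + ((c - κ * T) * D s + -κ * (E s * D s)) := fun s => by
      simp only [hUdef]; ring
    simp only [h2] at h1
    rw [integral_add (iUD M hM) i1, integral_add (iD.const_mul _) (iED.const_mul _),
      integral_const_mul, integral_const_mul, hD0] at h1
    linarith
  have hpos : ∀ M, M₁ ≤ M → ∀ s, 0 ≤ D s → k * D s ≤ U M s := by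
    intro M hM s hs
    simp only [hUdef]
    rcases le_total (work ell mu (pol.X s)) M with h1 | h1
    · rw [min_eq_left h1]
      exact hlower s
    · rw [min_eq_right h1]
      have h2 : c + k * δ ≤ M := (le_max_right _ _).trans hM
      have h3 := mul_le_mul_of_nonneg_left (hDδ s) hk.le
      have h4 : 0 ≤ κ * (T + E s) := mul_nonneg hκ (add_nonneg hT (hE0 s))
      linarith
  have hneg : ∀ M, M₁ ≤ M → ∀ s, D s < 0 → A * T * D s - A * H s ≤ U M s * D s := by
    intro M hM s hs
    have hs' : D s < δ - δ' := by linarith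
    have h1 : work ell mu (pol.X s) ≤ M := by
      rw [hXZ s hs']
      exact (pol.work_Z_le hK hKmu s).trans ((le_max_left _ _).trans hM)
    have h2 : U M s ≤ K * (D s + I * (T + E s)) := by
      simp only [hUdef]
      rw [min_eq_left h1]
      exact hupper s hs'
    have h3 : -(T + E s) ≤ D s := by
      rw [hDeq s hs']
      exact (neg_le_neg (hVR s)).trans (neg_shortfall_le _)
    have h4 := mul_le_mul_of_nonpos_right h2 hs.le
    -- From `-(T + E) ≤ D` the product is at least `-(T E + E²)`, and each term is at most `H`;
    -- hence the factor `2` in `A`.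
    have h5 : -(2 * H s) ≤ E s * D s := by
      have := mul_le_mul_of_nonneg_left h3 (hE0 s)
      nlinarith [hTEH s, hEH s]
    have h6 := mul_le_mul_of_nonneg_left h5 hKI0
    have h7 : A * (T * D s) ≤ K * I * (T * D s) :=
      mul_le_mul_of_nonpos_right hKIA (mul_nonpos_of_nonneg_of_nonpos hT hs.le)
    have h8 := mul_le_mul_of_nonneg_right hKIA2 ((sq_nonneg _).trans (hEH s))
    have h9 := mul_nonneg hK (sq_nonneg (D s))
    nlinarith
  refine ⟨∫ s, max (D s) 0 ∂π.toMeasure, ∫ s, E s ∂π.toMeasure,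
    integral_nonneg fun s => le_max_right _ _,
    integral_posPart_le_of_integral_eq_zero iD hDδ (hδ'.trans hδ.le),
    integral_nonneg hE0, ?_, ?_, ?_, M₁, fun N hN => ?_⟩
  · rw [← integral_const_mul]
    exact (integral_mono (iE.const_mul T) iH hTEH).trans hHh
  · intro h0
    have : ∀ s, E s = 0 := fun s => by simp [hEdef, hVT h0 s, h0]
    simp [this]
  · exact sq_integral_posPart_le iD iH (iUD M₁ le_rfl) iED hk hκ hD0 (hU M₁ le_rfl) hE0 hEH
      (hpos M₁ le_rfl) (hneg M₁ le_rfl) hA0 hHh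
  · have hKn : 0 ≤ K * n := mul_nonneg hK (Nat.cast_nonneg n)
    -- Work in service is at most `K * n`, so truncating the work at `N + K * n` leaves room for the
    -- workload truncated at `N`.
    have hM : M₁ ≤ N + K * n := by linarith
    have hN0 : 0 ≤ N := hM₁0.trans hN
    have iq : Integrable (fun s => min (pol.workload mu s) N) π.toMeasure :=
      integrable_of_abs_le (C := N) fun s => by
        rw [abs_of_nonneg (le_min (pol.workload_nonneg hmu s) hN0)]
        exact min_le_right _ _
    refine mul_integral_le_of_drift iD iH iE iZ iq (igU _ hM) (iUD _ hM) iED hk hκ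
      (sub_pos.mpr hδ) hD0 hDδ (hU _ hM) hE0 hEH (hpos _ hM) (hneg _ hM) hA0 hHh ?_ ?_ hZ0 hgZ
    · intro s
      simp only [hgdef]
      split_ifs with hs
      · exact Or.inl rfl
      · exact Or.inr ⟨rfl, not_lt.mp hs⟩
    · intro s
      have h1 := pol.workload_eq (mu := mu) s
      by_cases hs : D s < δ - δ'
      · simp only [hgdef, hs, if_true, zero_mul]
        rw [h1, hXZ s hs, sub_self]
        exact min_le_left _ _
      · simp only [hgdef, hs, if_false, one_mul, hUdef, hZdef]
        have h2 := pol.work_Z_le hK hKmu s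
        have h3 : 0 ≤ κ * (T + E s) := mul_nonneg hκ (add_nonneg hT (hE0 s))
        have h4 : min (pol.workload mu s) N + work ell mu (pol.Z s) ≤
            min (work ell mu (pol.X s)) (N + K * n) :=
          le_min (by linarith [min_le_left (pol.workload mu s) N])
            (by linarith [min_le_right (pol.workload mu s) N])
        linarith

end TruncatedWorkload
end Policy
end MultiserverJob

/-! ### Bounds on the expected workload with constants depending only on the service rates -/

theorem le_mul_of_half_sq_le {k A b L d : ℝ} (hk : 0 < k) (hA : 0 ≤ A) (hb : 0 ≤ b) (hL : 0 ≤ L)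
    (h : k / 2 * d ^ 2 ≤ b * L ^ 2 + A * L * d) :
    d ≤ (2 * (A + b) / k + 1) * L := by
  by_contra! hlt
  have h0 : 0 ≤ 2 * (A + b) / k := by positivity
  have hLd : L ≤ d := by nlinarith
  have hd0 : 0 < d := lt_of_le_of_lt (by positivity) hlt
  have h1 : k / 2 * ((2 * (A + b) / k + 1) * L) = (A + b) * L + k / 2 * L := by
    field_simp
  have h2 := mul_lt_mul_of_pos_left hlt (by positivity : 0 < k / 2)
  rw [h1] at h2
  have h3 := mul_lt_mul_of_pos_right h2 hd0
  have h4 : b * L * L ≤ b * L * d := mul_le_mul_of_nonneg_left hLd (mul_nonneg hb hL)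
  have h5 : 0 ≤ k / 2 * L * d := by positivity
  nlinarith

theorem exists_bounds_one_div {ι : Type*} [Fintype ι] {mu : ι → ℝ}
    (hmu : ∀ i, 0 < mu i) : ∃ k K : ℝ, 0 < k ∧ 0 ≤ K ∧ (∀ i, k ≤ 1 / mu i) ∧ ∀ i, 1 / mu i ≤ K := by
  have h0 : 0 ≤ ∑ i, mu i := Finset.sum_nonneg fun i _ => (hmu i).le
  refine ⟨1 / (1 + ∑ i, mu i), ∑ i, 1 / mu i, by positivity,
    Finset.sum_nonneg fun i _ => (one_div_pos.mpr (hmu i)).le, fun i => ?_, fun i => ?_⟩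
  · refine one_div_le_one_div_of_le (hmu i) ?_
    have := Finset.single_le_sum (f := mu) (fun i _ => (hmu i).le) (Finset.mem_univ i)
    linarith
  · exact Finset.single_le_sum (f := fun i => 1 / mu i)
      (fun i _ => (one_div_pos.mpr (hmu i)).le) (Finset.mem_univ i)

namespace MultiserverJob
namespace Policy
open MeasureTheory

section ExpectedWorkload

variable {I : ℕ} {n : ℕ} {ell : Fin I → ℕ} {S : Type*}
variable {pol : Policy n ell S} {lam mu : Fin I → ℝ}

theorem expectedWorkload_le_of_integral_min_le [Countable S] [MeasurableSpace S]
    [DiscreteMeasurableSpace S] (hmu : ∀ i, 0 < mu i) {π : PMF S} {N₀ b : ℝ}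
    (h : ∀ N, N₀ ≤ N → ∫ s, min (pol.workload mu s) N ∂π.toMeasure ≤ b) :
    pol.expectedWorkload mu π ≤ ENNReal.ofReal b := by
  unfold expectedWorkload
  rw [ENNReal.tsum_eq_iSup_sum]
  refine iSup_le fun F => ?_
  -- Large enough that the truncation is inactive on the finite set `F`.
  set N := max (max N₀ 0) (∑ s ∈ F, pol.workload mu s) with hN
  have hN0 : 0 ≤ N := (le_max_right _ _).trans (le_max_left _ _)
  have hq0 : ∀ s, 0 ≤ min (pol.workload mu s) N := fun s => le_min (pol.workload_nonneg hmu s) hN0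
  have hint : Integrable (fun s => min (pol.workload mu s) N) π.toMeasure :=
    integrable_of_abs_le (C := N) fun s => by
      rw [abs_of_nonneg (hq0 s)]
      exact min_le_right _ _
  have h1 := h N ((le_max_left _ _).trans (le_max_left _ _))
  rw [PMF.integral_eq_tsum _ _ hint] at h1
  have hsum : Summable fun s => (π s).toReal • min (pol.workload mu s) N :=
    Summable.of_nonneg_of_le (fun s => mul_nonneg ENNReal.toReal_nonneg (hq0 s))
      (fun s => mul_le_mul_of_nonneg_left (min_le_right _ _) ENNReal.toReal_nonneg)
      (π.hasSum_toReal.summable.mul_right N)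
  have h2 := (hsum.sum_le_tsum F
    (fun s _ => mul_nonneg ENNReal.toReal_nonneg (hq0 s))).trans h1
  refine le_trans (le_of_eq ?_) (ENNReal.ofReal_le_ofReal h2)
  rw [ENNReal.ofReal_sum_of_nonneg fun s _ => mul_nonneg ENNReal.toReal_nonneg (hq0 s)]
  refine Finset.sum_congr rfl fun s hs => ?_
  have h3 : pol.workload mu s ≤ N :=
    (Finset.single_le_sum (f := pol.workload mu) (fun s _ => pol.workload_nonneg hmu s) hs).trans
      (le_max_right _ _)
  rw [min_eq_left h3, ENNReal.ofReal_mul ENNReal.toReal_nonneg,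
    ENNReal.ofReal_toReal (π.apply_ne_top s)]

/-- The first bound keeps the coefficient `1` of `σ²` and uses only `d ≤ δ`. The second gives up
this coefficient but uses `d = O(σ Λ)`, which removes the term `δ²`. -/
theorem exists_const_expectedWorkload_le (hmu : ∀ i, 0 < mu i) :
    ∃ C : ℝ, 0 ≤ C ∧ ∀ (n : ℕ) (lam : Fin I → ℝ) (ell : Fin I → ℕ) (δ' Λ : ℝ),
      (∀ i, 0 ≤ lam i) → (∀ i, 1 ≤ ell i) → 0 ≤ δ' → δ' < slack n lam mu ell → 1 ≤ Λ →
      ∀ (S : Type u) [Countable S] (pol : Policy n ell S) (π : PMF S),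
        pol.WorkConserving δ' → pol.IsSteadyState lam mu π →
        pol.expectedWorkload mu π ≤ ENNReal.ofReal ((workVariability lam mu ell +
            C * (√(workVariability lam mu ell) * Λ * slack n lam mu ell +
              workVariability lam mu ell / Λ ^ 2 + slack n lam mu ell ^ 2)) /
            (slack n lam mu ell - δ')) ∧
        pol.expectedWorkload mu π ≤ ENNReal.ofReal (C * (workVariability lam mu ell +
            √(workVariability lam mu ell) * Λ * slack n lam mu ell) /
            (slack n lam mu ell - δ')) := by
  obtain ⟨k, K, hk, hK, hkmu, hKmu⟩ := exists_bounds_one_div hmu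
  set κ := ∑ i, 1 / mu i with hκdef
  have hκ : 0 ≤ κ := Finset.sum_nonneg fun i _ => (one_div_pos.mpr (hmu i)).le
  set A := 2 * K * ((I : ℝ) + 1) with hAdef
  have hA : 0 ≤ A := by positivity
  set c₁ := 10 * (I : ℝ) ^ 4 / k ^ 2 with hc₁def
  have hc₁ : 0 ≤ c₁ := by positivity
  set c₂ := (A + κ ^ 2 / (2 * k)) * c₁ with hc₂def
  have hc₂ : 0 ≤ c₂ := by positivity
  set c₃ := 2 * (A + (1 + c₂)) / k + 1 with hc₃def
  have hc₃ : 0 ≤ c₃ := by positivity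
  set C := 1 + A + (A + κ) * c₁ + κ + κ * c₃ + A * (1 + c₃ + c₁) with hCdef
  have p1 : 0 ≤ (A + κ) * c₁ := by positivity
  have p2 : 0 ≤ κ * c₃ := by positivity
  have p3 : 0 ≤ A * c₃ := by positivity
  have p4 : 0 ≤ A * c₁ := by positivity
  refine ⟨C, by positivity, ?_⟩
  intro n lam ell δ' Λ hlam hell hδ' hδ hΛ S _ pol π hwc hss
  let _ : MeasurableSpace S := ⊤
  have : DiscreteMeasurableSpace S := ⟨fun _ => trivial⟩
  set v := workVariability lam mu ell with hvdef
  have hv : 0 ≤ v := workVariability_nonneg hlam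
  set δ := slack n lam mu ell with hδdef
  set L := √v * Λ with hLdef
  have hΛ0 : 0 < Λ := by linarith
  have hL : 0 ≤ L := by positivity
  have hL2 : L ^ 2 = v * Λ ^ 2 := by rw [hLdef, mul_pow, Real.sq_sqrt hv]
  have hL0 : L = 0 → v = 0 := fun h0 => by
    rcases mul_eq_zero.mp h0 with h1 | h1
    · exact (Real.sqrt_eq_zero hv).mp h1
    · linarith
  obtain ⟨d, e, hd, hdδ, he, hTe, he0, hdsq, N₀, hN⟩ :=
    pol.exists_mul_integral_min_workload_le hlam hmu hell hss hwc hδ' hδ hk hkmu hK hKmu hL hL0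
      hAdef rfl
  rw [← hvdef, ← hδdef] at *
  -- With the cut at `T = L = √v * Λ`, the fourth moment makes the excess of order `v / Λ ^ 2`,
  -- negligible against `v` as `Λ → ∞`.
  have hh : c₁ * v ^ 2 / L ^ 2 = c₁ * (v / Λ ^ 2) := by
    rw [hL2]
    rcases eq_or_ne v 0 with h0 | h0
    · simp [h0]
    · field_simp
  rw [← hc₁def, hh] at hTe hdsq hN
  have hΛ2 : 1 ≤ Λ ^ 2 := one_le_pow₀ hΛ
  have hvL : v ≤ L ^ 2 := by rw [hL2]; nlinarith
  have hvΛ : v / Λ ^ 2 ≤ v := div_le_self hv hΛ2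
  have hvΛ0 : 0 ≤ v / Λ ^ 2 := by positivity
  have hδ0 : 0 < δ := by linarith
  have hdL : d ≤ c₃ * L := by
    refine le_mul_of_half_sq_le hk hA (by positivity) hL (hdsq.trans ?_)
    have h1 : c₂ * (v / Λ ^ 2) ≤ c₂ * L ^ 2 :=
      mul_le_mul_of_nonneg_left (hvΛ.trans hvL) hc₂
    rw [hc₂def] at h1 ⊢
    linarith
  have heL : e ≤ c₁ * L := by
    rcases hL.eq_or_lt with h0 | h0
    · rw [he0 h0.symm, ← h0, mul_zero]
    · refine le_of_mul_le_mul_left (hTe.trans ?_) h0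
      have := mul_le_mul_of_nonneg_left (hvΛ.trans hvL) hc₁
      linarith
  have hγ : 0 < δ - δ' := sub_pos.mpr hδ
  have hγδ : ∀ x, 0 ≤ x → (δ - δ') * x ≤ δ * x := fun x hx =>
    mul_le_mul_of_nonneg_right (by linarith) hx
  have q1 : 0 ≤ L * δ := mul_nonneg hL hδ0.le
  have q2 : A * L * d ≤ A * L * δ := mul_le_mul_of_nonneg_left hdδ (mul_nonneg hA hL)
  have q3 : κ * δ * d ≤ κ * δ * δ := mul_le_mul_of_nonneg_left hdδ (mul_nonneg hκ hδ0.le)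
  have q4 : κ * δ * d ≤ κ * δ * (c₃ * L) := mul_le_mul_of_nonneg_left hdL (mul_nonneg hκ hδ0.le)
  have q5 : δ * (A * (d + L + e)) ≤ δ * (A * (δ + L + c₁ * L)) :=
    mul_le_mul_of_nonneg_left (mul_le_mul_of_nonneg_left (by linarith) hA) hδ0.le
  have q6 : δ * (A * (d + L + e)) ≤ δ * (A * (c₃ * L + L + c₁ * L)) :=
    mul_le_mul_of_nonneg_left (mul_le_mul_of_nonneg_left (by linarith) hA) hδ0.le
  have q7 := hγδ (A * (d + L + e)) (mul_nonneg hA (by linarith))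
  have q8 : (A + κ) * c₁ * (v / Λ ^ 2) ≤ (A + κ) * c₁ * v := mul_le_mul_of_nonneg_left hvΛ p1
  have r1 := sq_nonneg δ
  constructor
  · refine pol.expectedWorkload_le_of_integral_min_le hmu (N₀ := N₀) fun N hNN => ?_
    rw [le_div_iff₀' hγ]
    refine (hN N hNN).trans ?_
    have s1 : A * (L * δ) + A * (1 + c₁) * (L * δ) ≤ C * (L * δ) := by
      rw [← add_mul]
      exact mul_le_mul_of_nonneg_right (by rw [hCdef]; linarith) q1
    have s2 : (A + κ) * c₁ * (v / Λ ^ 2) ≤ C * (v / Λ ^ 2) :=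
      mul_le_mul_of_nonneg_right (by rw [hCdef]; linarith) hvΛ0
    have s3 : (κ + A) * δ ^ 2 ≤ C * δ ^ 2 :=
      mul_le_mul_of_nonneg_right (by rw [hCdef]; linarith) r1
    linarith
  · refine pol.expectedWorkload_le_of_integral_min_le hmu (N₀ := N₀) fun N hNN => ?_
    rw [le_div_iff₀' hγ]
    refine (hN N hNN).trans ?_
    have s1 : (A + κ * c₃ + A * (1 + c₃ + c₁)) * (L * δ) ≤ C * (L * δ) :=
      mul_le_mul_of_nonneg_right (by rw [hCdef]; linarith) q1
    have s2 : (1 + (A + κ) * c₁) * v ≤ C * v :=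
      mul_le_mul_of_nonneg_right (by rw [hCdef]; linarith) hv
    linarith

end ExpectedWorkload
end Policy
end MultiserverJob

/-! ### Asymptotics with `Λ = log n` -/

theorem lemma2 {I : ℕ} (mu : Fin I → ℝ) (hmu : ∀ i, 0 < mu i)
    (lam : ℕ → Fin I → ℝ) (ell : ℕ → Fin I → ℕ)
    (hlam : ∀ᶠ n in atTop, ∀ i, 0 ≤ lam n i)
    (hell : ∀ᶠ n in atTop, ∀ i, 1 ≤ ell n i)
    (hslack : ∀ᶠ n in atTop, 0 < MultiserverJob.slack n (lam n) mu (ell n))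
    (ε₀ : ℝ) (hε₀ : 0 < ε₀) (hε₀' : ε₀ < 1) :
    ((fun n : ℕ => MultiserverJob.slack n (lam n) mu (ell n)) =o[atTop]
        (fun n : ℕ => √(MultiserverJob.workVariability (lam n) mu (ell n)) / Real.log n) →
      (∃ ε : ℕ → ℝ, Tendsto ε atTop (𝓝 0) ∧
        ∀ᶠ n in atTop, ∀ δ' : ℝ, 0 ≤ δ' →
          δ' ≤ ε₀ * MultiserverJob.slack n (lam n) mu (ell n) →
          ∀ (S : Type u) [Countable S] (pol : MultiserverJob.Policy n (ell n) S) (π : PMF S),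
            pol.WorkConserving δ' → pol.IsSteadyState (lam n) mu π →
            pol.expectedWorkload mu π ≤
              ENNReal.ofReal (MultiserverJob.workVariability (lam n) mu (ell n) /
                (MultiserverJob.slack n (lam n) mu (ell n) - δ') * (1 + ε n))) ∧
      (∃ C : ℝ, ∀ᶠ n in atTop, ∀ δ' : ℝ, 0 ≤ δ' →
          δ' ≤ ε₀ * MultiserverJob.slack n (lam n) mu (ell n) →
          ∀ (S : Type u) [Countable S] (pol : MultiserverJob.Policy n (ell n) S) (π : PMF S),
            pol.WorkConserving δ' → pol.IsSteadyState (lam n) mu π →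
            pol.expectedWorkload mu π ≤
              ENNReal.ofReal (C * (MultiserverJob.workVariability (lam n) mu (ell n) /
                MultiserverJob.slack n (lam n) mu (ell n))))) ∧
    ((fun n : ℕ => √(MultiserverJob.workVariability (lam n) mu (ell n)) / Real.log n) =O[atTop]
        (fun n : ℕ => MultiserverJob.slack n (lam n) mu (ell n)) →
      ∃ C : ℝ, ∀ᶠ n in atTop, ∀ δ' : ℝ, 0 ≤ δ' →
        δ' ≤ ε₀ * MultiserverJob.slack n (lam n) mu (ell n) →
        ∀ (S : Type u) [Countable S] (pol : MultiserverJob.Policy n (ell n) S) (π : PMF S),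
          pol.WorkConserving δ' → pol.IsSteadyState (lam n) mu π →
          pol.expectedWorkload mu π ≤
            ENNReal.ofReal
              (C * (√(MultiserverJob.workVariability (lam n) mu (ell n)) * Real.log n))) := by
  obtain ⟨C, hC, hbound⟩ := MultiserverJob.Policy.exists_const_expectedWorkload_le.{u} hmu
  have hlog : Tendsto (fun n : ℕ => Real.log n) atTop atTop :=
    Real.tendsto_log_atTop.comp tendsto_natCast_atTop_atTop
  have hinv : Tendsto (fun n : ℕ => 1 / Real.log n) atTop (𝓝 0) := by
    simp only [one_div]
    exact hlog.inv_tendsto_atTop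
  have hlog1 : ∀ᶠ n : ℕ in atTop, 1 ≤ Real.log n := hlog.eventually_ge_atTop 1
  have hgap : ∀ {δ δ' : ℝ}, δ' ≤ ε₀ * δ → (1 - ε₀) * δ ≤ δ - δ' := fun h => by linarith
  have hε₁ : 0 < 1 - ε₀ := by linarith
  have hv0 : ∀ᶠ n : ℕ in atTop, 0 ≤ MultiserverJob.workVariability (lam n) mu (ell n) :=
    hlam.mono fun n hn => MultiserverJob.workVariability_nonneg hn
  refine ⟨fun ho => ?_, fun hO => ?_⟩
  · set r : ℕ → ℝ := fun n => MultiserverJob.slack n (lam n) mu (ell n) /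
      (√(MultiserverJob.workVariability (lam n) mu (ell n)) / Real.log n) with hr
    have hr0 : Tendsto r atTop (𝓝 0) := ho.tendsto_div_nhds_zero
    -- If `σ²` vanished, the little-o bound would force `δ = 0`.
    have hvpos : ∀ᶠ n : ℕ in atTop, 0 < √(MultiserverJob.workVariability (lam n) mu (ell n)) := by
      filter_upwards [ho.bound one_pos, hslack, hlog1] with n h1 h2 h3
      refine lt_of_le_of_ne (Real.sqrt_nonneg _) fun h0 => ?_
      rw [← h0, zero_div, norm_zero, mul_zero, Real.norm_eq_abs, abs_of_pos h2] at h1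
      linarith
    constructor
    · refine ⟨fun n => C * (r n + (1 / Real.log n) ^ 2 + (r n * (1 / Real.log n)) ^ 2), ?_, ?_⟩
      · have := ((hr0.add (hinv.pow 2)).add ((hr0.mul hinv).pow 2)).const_mul C
        simpa using this
      · filter_upwards [hlam, hell, hslack, hlog1, hvpos, hv0] with
          n h1 h2 h3 h4 h5 h6 δ' hδ0 hδ' S _ pol π hwc hss
        have hδ : δ' < MultiserverJob.slack n (lam n) mu (ell n) := by nlinarith
        refine (hbound n (lam n) (ell n) δ' _ h1 h2 hδ0 hδ h4 S pol π hwc hss).1.trans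
          (ENNReal.ofReal_le_ofReal (le_of_eq ?_))
        simp only [hr]
        have h7 : MultiserverJob.workVariability (lam n) mu (ell n) =
          √(MultiserverJob.workVariability (lam n) mu (ell n)) ^ 2 := (Real.sq_sqrt h6).symm
        set w := √(MultiserverJob.workVariability (lam n) mu (ell n))
        have h8 : 0 < Real.log n := by linarith
        have h9 := sub_pos.mpr hδ
        rw [h7]
        field_simp
    · refine ⟨2 * C / (1 - ε₀), ?_⟩
      filter_upwards [hlam, hell, hslack, hlog1, hvpos, hv0, hr0.eventually_le_const one_pos] with
        n h1 h2 h3 h4 h5 h6 hr1 δ' hδ0 hδ' S _ pol π hwc hss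
      have hδ : δ' < MultiserverJob.slack n (lam n) mu (ell n) := by nlinarith
      refine (hbound n (lam n) (ell n) δ' _ h1 h2 hδ0 hδ h4 S pol π hwc hss).2.trans
        (ENNReal.ofReal_le_ofReal ?_)
      have h7 := Real.sq_sqrt h6
      simp only [hr] at hr1
      set v := MultiserverJob.workVariability (lam n) mu (ell n)
      set δ := MultiserverJob.slack n (lam n) mu (ell n)
      have h8 : 0 < Real.log n := by linarith
      rw [div_le_one (by positivity), le_div_iff₀ h8] at hr1
      -- This is `r ≤ 1` multiplied by `v`; in the second regime the comparison goes the other way,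
      -- with the constant `C₀`.
      have h9 : √v * Real.log n * δ ≤ v := by nlinarith
      calc C * (v + √v * Real.log n * δ) / (δ - δ')
          ≤ C * (v + √v * Real.log n * δ) / ((1 - ε₀) * δ) :=
            div_le_div_of_nonneg_left (by positivity) (by positivity) (hgap hδ')
        _ ≤ C * (v + v) / ((1 - ε₀) * δ) := by gcongr
        _ = 2 * C / (1 - ε₀) * (v / δ) := by field_simp; ring
  · obtain ⟨C₀, hC₀, hOb⟩ := hO.exists_pos
    refine ⟨C * (C₀ + 1) / (1 - ε₀), ?_⟩
    filter_upwards [hlam, hell, hslack, hlog1, hv0, hOb.bound] with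
      n h1 h2 h3 h4 h6 hb δ' hδ0 hδ' S _ pol π hwc hss
    have hδ : δ' < MultiserverJob.slack n (lam n) mu (ell n) := by nlinarith
    refine (hbound n (lam n) (ell n) δ' _ h1 h2 hδ0 hδ h4 S pol π hwc hss).2.trans
      (ENNReal.ofReal_le_ofReal ?_)
    have h7 := Real.sq_sqrt h6
    have h8 : 0 < Real.log n := by linarith
    rw [Real.norm_eq_abs, Real.norm_eq_abs, abs_of_pos h3, abs_of_nonneg (by positivity),
      div_le_iff₀ h8] at hb
    set v := MultiserverJob.workVariability (lam n) mu (ell n)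
    set δ := MultiserverJob.slack n (lam n) mu (ell n)
    have h9 : v ≤ C₀ * (√v * Real.log n * δ) := by
      have := mul_le_mul_of_nonneg_left hb (Real.sqrt_nonneg v)
      nlinarith
    calc C * (v + √v * Real.log n * δ) / (δ - δ')
        ≤ C * (v + √v * Real.log n * δ) / ((1 - ε₀) * δ) :=
          div_le_div_of_nonneg_left (by positivity) (by positivity) (hgap hδ')
      _ ≤ C * (C₀ * (√v * Real.log n * δ) + √v * Real.log n * δ) / ((1 - ε₀) * δ) := by gcongr
      _ = C * (C₀ + 1) / (1 - ε₀) * (√v * Real.log n) := by field_simp
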